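/- Let $d\ge 5$ and $n\ge 4$. For $x\in\mathbb{Z}^d$ let $\mathbb{P}_x$ be the law of simple random walk $(S_t)_{t\ge 0}$ in $\mathbb{Z}^d$ started from $x$, and for $A\subseteq\mathbb{Z}^d$ let $\tau_A=\inf\{t\ge 1: S_t\in A\}$. For a nonempty finite $A$, the harmonic measure is $$\mathbb{H}_A(y)=\lim_{x\to\infty}\mathbb{P}_x\big(S_{\tau_A}=y \mid \tau_A<\infty\big).$$ Harmonic activation and transport (HAT) is the Markov chain $(U_t)_{t\ge0}$ on the finite subsets of $\mathbb{Z}^d$ with at least two elements (configurations), with law $\mathbf{P}_U$ when $U_0=U$, whose transition probability from $U$ to $W$ is the sum of $$p_U(x,y)=\mathbb{H}_U(x)\,\mathbb{P}_x\big(S_{\tau-1}=y\mid\tau<\infty\big),\qquad \tau=\tau_{U\setminus\{x\}},$$ over the pairs $(x,y)$ with $W=(U\setminus\{x\})\cup\{y\}$. An $n$-element configuration $U$ is isolated if no $x\in U$ with $\mathbb{H}_U(x)>0$ has a neighbor (an element at distance $1$) in $U$, and non-isolated otherwise. Let $\mathrm{NonIso}_{d,n}$ be the set of non-isolated $n$-element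 configurations, and for a configuration $W$ let $\widehat W$ be its equivalence class under the symmetries (isometries) of $\mathbb{Z}^d$. Let $L_n=\{(j,0,\dots,0):1\le j\le n\}\subset\mathbb{Z}^d$. **Theorem (Irreducibility).** HAT is irreducible on the equivalence classes of the elements of $\mathrm{NonIso}_{d,n}$. That is, every one-step transition of positive probability from an element of $\mathrm{NonIso}_{d,n}$ leads to an element of $\mathrm{NonIso}_{d,n}$, and for all $U,V\in\mathrm{NonIso}_{d,n}$ there is $t\ge1$ with $\mathbf{P}_U(\widehat U_t=\widehat V)>0$. Moreover, for every $n$-element configuration $U$, isolated or not, there is $t\ge1$ with $\mathbf{P}_U(\widehat U_t=\widehat L_n)>0$, and for every $U\in\mathrm{NonIso}_{d,n}$ there is $t\ge1$ with $\mathbf{P}_{L_n}(\widehat U_t=\widehat U)>0$. -/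

import Mathlib

open MeasureTheory ProbabilityTheory Filter
open scoped ENNReal

noncomputable section

namespace HAT

/-! ### The lattice `ℤ^d` -/

/-- Points of `ℤ^d`. -/
abbrev Site (d : ℕ) : Type := Fin d → ℤ

/-- Two points of `ℤ^d` are neighbors if they are at (`ℓ¹`, equivalently Euclidean) distance 1. -/
def Adj {d : ℕ} (x y : Site d) : Prop := ∑ i, |x i - y i| = 1

/-- The symmetries of `ℤ^d`: the bijections that preserve Euclidean distance (the group generated
by translations, coordinate permutations and coordinate reflections). -/
def IsSymmetry {d : ℕ} (g : Equiv.Perm (Site d)) : Prop :=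
  ∀ x y, ∑ i, (g x i - g y i) ^ 2 = ∑ i, (x i - y i) ^ 2

/-- `U` and `V` are in the same class under symmetries of `ℤ^d`, i.e. `V = g U` for some
symmetry `g`. -/
def SameClass {d : ℕ} (U V : Finset (Site d)) : Prop :=
  ∃ g : Equiv.Perm (Site d), IsSymmetry g ∧ V = U.map g.toEmbedding

/-! ### Simple random walk on `ℤ^d` -/

/-- The `2d` directions of a step: a coordinate and a sign. -/
abbrev Dir (d : ℕ) : Type := Fin d × Bool

/-- The unit vector `e_i` (for `(i, true)`) or `-e_i` (for `(i, false)`). -/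
def stepVec {d : ℕ} (s : Dir d) : Site d := Pi.single s.1 (if s.2 then 1 else -1)

/-- The law of an i.i.d. sequence of uniformly distributed directions. -/
def walkLaw (d : ℕ) : Measure (ℕ → Dir d) :=
  Measure.infinitePi fun _ => uniformOn (Set.univ : Set (Dir d))

/-- The position `S_t` of the walk started from `x` with directions `ω`. Under `walkLaw d`, this is
simple random walk from `x`. -/
def walk {d : ℕ} (x : Site d) (ω : ℕ → Dir d) (t : ℕ) : Site d :=
  x + ∑ k ∈ Finset.range t, stepVec (ω k)

/-- The event `τ_A < ∞` for the walk from `x`, where `τ_A = inf {t ≥ 1 : S_t ∈ A}`. -/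
def hits {d : ℕ} (A : Finset (Site d)) (x : Site d) : Set (ℕ → Dir d) :=
  {ω | ∃ t, 1 ≤ t ∧ walk x ω t ∈ A}

/-- The first return time `τ_A = inf {t ≥ 1 : S_t ∈ A}` of the walk from `x`; it is only used on
the event `hits A x`. -/
def tau {d : ℕ} (A : Finset (Site d)) (x : Site d) (ω : ℕ → Dir d) : ℕ :=
  sInf {t | 1 ≤ t ∧ walk x ω t ∈ A}

/-- `ℙ_x (S_{τ_A} = y | τ_A < ∞)`. -/
def hitProb {d : ℕ} (A : Finset (Site d)) (x y : Site d) : ℝ≥0∞ :=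
  (walkLaw d)[|hits A x] {ω | walk x ω (tau A x ω) = y}

/-- `ℙ_x (S_{τ_A - 1} = y | τ_A < ∞)`. -/
def leaveProb {d : ℕ} (A : Finset (Site d)) (x y : Site d) : ℝ≥0∞ :=
  (walkLaw d)[|hits A x] {ω | walk x ω (tau A x ω - 1) = y}

/-- The harmonic measure `H_A (y)`, the limit as `x → ∞` of `ℙ_x (S_{τ_A} = y | τ_A < ∞)`.
It is used for finite nonempty `A`, for which the limit exists. -/
def harmonicMeasure {d : ℕ} (A : Finset (Site d)) (y : Site d) : ℝ≥0∞ :=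
  limUnder cofinite fun x : Site d => hitProb A x y

/-! ### Harmonic activation and transport -/

/-- The probability `p_U (x, y)` that, from `U`, activation occurs at `x` and transport occurs
to `y`. -/
def actTransProb {d : ℕ} (U : Finset (Site d)) (x y : Site d) : ℝ≥0∞ :=
  harmonicMeasure U x * leaveProb (U.erase x) x y

/-- The one-step transition probability of HAT from `U` to `W`: the sum of `p_U (x, y)` over the
pairs `(x, y)` with `W = (U \ {x}) ∪ {y}`. -/
def transProb {d : ℕ} (U W : Finset (Site d)) : ℝ≥0∞ :=
  ∑' (x : Site d) (y : Site d), if insert y (U.erase x) = W then actTransProb U x y else 0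

/-- The `t`-step transition probability `𝐏_U (U_t = W)` of the Markov chain with transition
probabilities `transProb`. -/
def stepProb {d : ℕ} : ℕ → Finset (Site d) → Finset (Site d) → ℝ≥0∞
  | 0, U, W => if U = W then 1 else 0
  | t + 1, U, W => ∑' V : Finset (Site d), transProb U V * stepProb t V W

open Classical in
/-- The probability that, from `U`, the class of the configuration at time `t` is the class
of `V`. -/
def classProb {d : ℕ} (t : ℕ) (U V : Finset (Site d)) : ℝ≥0∞ :=
  ∑' W : Finset (Site d), if SameClass V W then stepProb t U W else 0

/-- From `U`, HAT reaches the class of `V` at some time `t ≥ 1` with positive probability. -/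
def Reaches {d : ℕ} (U V : Finset (Site d)) : Prop :=
  ∃ t, 1 ≤ t ∧ 0 < classProb t U V

/-- `x` is an exposed element of `A`. -/
def Exposed {d : ℕ} (A : Finset (Site d)) (x : Site d) : Prop :=
  x ∈ A ∧ 0 < harmonicMeasure A x

/-- The isolated `n`-element configurations: no exposed element has a neighbor in the
configuration. -/
def Iso (d n : ℕ) : Set (Finset (Site d)) :=
  {U | U.card = n ∧ ∀ x, Exposed U x → ∀ y ∈ U, ¬ Adj x y}

/-- The non-isolated `n`-element configurations: all the other ones. -/
def NonIso (d n : ℕ) : Set (Finset (Site d)) :=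
  {U | U.card = n ∧ U ∉ Iso d n}

/-- HAT, viewed on classes of configurations under symmetries of `ℤ^d`, is irreducible on (the
classes of) the set `C` of configurations: it does not leave `C`, and from each element of `C` it
reaches the class of each element of `C` with positive probability. -/
def IrreducibleOn {d : ℕ} (C : Set (Finset (Site d))) : Prop :=
  (∀ U ∈ C, ∀ W, 0 < transProb U W → W ∈ C) ∧ ∀ U ∈ C, ∀ V ∈ C, Reaches U V

/-- The line segment `{(j, 0, …, 0) : 1 ≤ j ≤ n}` in `ℤ^d`. -/
def line (d n : ℕ) : Finset (Site d) :=
  (Finset.Icc 1 n).image fun (j : ℕ) (i : Fin d) => if (i : ℕ) = 0 then (j : ℤ) else 0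

end HAT

end

/-! The proof has an analytic half, which decides which transitions have positive probability, and a
combinatorial half, which finds enough of them.

Analytic half. By reversibility (`hitKer_symm`) and the decomposition at the first return to `A`
(`visits_eq_first_visit`), the probability of entering `A` from a far point `x` at `y`, divided by
the Green function `G(0, x)`, is `G(y, x) / G(0, x) - ∑ z ∈ A, hitKer A y z * G(z, x) / G(0, x)`.
The ratios of Green functions tend to 1: any limit of `w ↦ G(w, x) / G(0, x)` is a positive harmonic
function with value 1 at the origin, and the only one is the constant (`harmonicBase_eq_one`, by
Krein–Milman). So harmonic measure is the normalized escape probability, and by transience it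
charges `y` exactly when an infinite component of the complement of `A` can be reached from `y`
(`exposed_iff`). Hence positivity of a transition is a statement about lattice paths
(`transProb_pos_iff`).

Combinatorial half. The transported element ends in the exterior and next to another element, so
every transition leads to a non-isolated configuration (`Trans.mem_nonIso`). The exterior is
connected (`Ext.conn`), so a non-isolated configuration is a set `A` together with one free element,
which can go from any exterior site next to `A` to any other. The free element can serve to move an
element of `A` by one site (`reflTransGen_trans_of_slide`). Such slides are reversible and bring `A`
to a segment far to the left: the lexicographically least element is repeatedly pulled off and
appended to the segment (`reflTransGen_slide_union_seg`). Two non-isolated configurations are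
therefore joined through a segment, up to a translation, and an isolated configuration first makes
an arbitrary transition (`exists_trans`). -/

open scoped Topology

noncomputable section

namespace HAT

variable {d : ℕ}

/-! ### The law of the walk -/

/-- The sequence of directions with first direction `s`, followed by `ω`. -/
def consSeq (s : Dir d) (ω : ℕ → Dir d) : ℕ → Dir d
  | 0 => s
  | n + 1 => ω n

/-- The average of `f` over the neighbors of `x`. -/
def avg (f : Site d → ℝ≥0∞) (x : Site d) : ℝ≥0∞ :=
  (Fintype.card (Dir d) : ℝ≥0∞)⁻¹ * ∑ s : Dir d, f (x + stepVec s)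

instance isProbabilityMeasure_uniformDir [NeZero d] :
    IsProbabilityMeasure (uniformOn (Set.univ : Set (Dir d))) :=
  isProbabilityMeasure_uniformOn Set.finite_univ Set.univ_nonempty

instance isProbabilityMeasure_walkLaw [NeZero d] : IsProbabilityMeasure (walkLaw d) := by
  unfold walkLaw; infer_instance

lemma measurable_consSeq (s : Dir d) : Measurable (consSeq s) := by
  refine measurable_pi_lambda _ fun n => ?_
  cases n with
  | zero => exact measurable_const
  | succ n => exact measurable_pi_apply n

lemma card_dir_ne_top : (Fintype.card (Dir d) : ℝ≥0∞) ≠ ∞ := ENNReal.natCast_ne_top _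

lemma walkLaw_pi_range [NeZero d] (N : ℕ) (t : ℕ → Set (Dir d)) :
    walkLaw d (Set.pi (Finset.range N : Set ℕ) t) =
      ∏ i ∈ Finset.range N, uniformOn (Set.univ : Set (Dir d)) (t i) :=
  Measure.infinitePi_pi _ fun _ _ => MeasurableSet.of_discrete

lemma consSeq_preimage_pi_range (N : ℕ) (t : ℕ → Set (Dir d)) (s : Dir d) [Decidable (s ∈ t 0)] :
    consSeq s ⁻¹' (Set.pi (Finset.range (N + 1) : Set ℕ) t) =
      if s ∈ t 0 then Set.pi (Finset.range N : Set ℕ) (fun i => t (i + 1)) else ∅ := by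
  ext ω
  simp only [Set.mem_preimage, Set.mem_pi, Finset.coe_range, Set.mem_Iio]
  constructor
  · intro h
    have h0 : s ∈ t 0 := h 0 (Nat.succ_pos _)
    rw [if_pos h0]
    exact fun i hi => h (i + 1) (by simpa using hi)
  · split_ifs with h0
    · intro h i hi
      cases i with
      | zero => exact h0
      | succ i => exact h i (by simpa using hi)
    · simp

-- Markov property at time 1. Both measures are compared on cylinders, enlarged to the coordinates
-- `0, …, N` so that coordinate 0 can be split off.
open Classical in
lemma walkLaw_eq_sum_map [NeZero d] :
    (Fintype.card (Dir d) : ℝ≥0∞)⁻¹ • ∑ s : Dir d, (walkLaw d).map (consSeq s) = walkLaw d := by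
  refine Measure.eq_infinitePi _ fun I t _ => ?_
  obtain ⟨N, hN⟩ : ∃ N, I ⊆ Finset.range (N + 1) :=
    ⟨I.sup id, fun i hi => Finset.mem_range.2 (Nat.lt_succ_of_le (Finset.le_sup (f := id) hi))⟩
  set t' : ℕ → Set (Dir d) := fun i => if i ∈ I then t i else Set.univ with ht'
  have h1 : Set.pi (I : Set ℕ) t = Set.pi (Finset.range (N + 1) : Set ℕ) t' := by
    ext ω
    simp only [Set.mem_pi, ht', Finset.mem_coe]
    constructor
    · intro h i _
      by_cases hi : i ∈ I
      · rw [if_pos hi]; exact h i hi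
      · rw [if_neg hi]; trivial
    · intro h i hi
      have := h i (hN hi)
      rwa [if_pos hi] at this
  have h2 : ∏ i ∈ I, uniformOn (Set.univ : Set (Dir d)) (t i) =
      ∏ i ∈ Finset.range (N + 1), uniformOn (Set.univ : Set (Dir d)) (t' i) := by
    rw [← Finset.prod_subset hN]
    · exact Finset.prod_congr rfl fun i hi => by simp [ht', hi]
    · intro i _ hi
      simp [ht', hi]
  have hms : MeasurableSet (Set.pi (Finset.range (N + 1) : Set ℕ) t') :=
    MeasurableSet.pi (Set.to_countable _) fun _ _ => MeasurableSet.of_discrete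
  rw [h1, h2, Finset.prod_range_succ', Measure.smul_apply, Measure.finsetSum_apply]
  simp_rw [Measure.map_apply (measurable_consSeq _) hms, consSeq_preimage_pi_range]
  have : ∀ s : Dir d, walkLaw d (if s ∈ t' 0 then Set.pi (Finset.range N : Set ℕ)
      (fun i => t' (i + 1)) else ∅) = (if s ∈ t' 0 then 1 else 0) *
        ∏ i ∈ Finset.range N, uniformOn (Set.univ : Set (Dir d)) (t' (i + 1)) := by
    intro s
    split_ifs
    · rw [walkLaw_pi_range, one_mul]
    · simp
  simp_rw [this, ← Finset.sum_mul, smul_eq_mul, uniformOn_univ (s := t' 0),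
    Measure.count_apply_finite _ (Set.toFinite (t' 0))]
  rw [mul_comm (∏ _ ∈ _, _), ← mul_assoc, div_eq_mul_inv, mul_comm (Finset.card _ : ℝ≥0∞)]
  congr 2
  simp [Finset.sum_boole, Set.toFinset_card]

lemma walkLaw_apply [NeZero d] {E : Set (ℕ → Dir d)} (hE : MeasurableSet E) :
    walkLaw d E = (Fintype.card (Dir d) : ℝ≥0∞)⁻¹ * ∑ s : Dir d, walkLaw d (consSeq s ⁻¹' E) := by
  conv_lhs => rw [← walkLaw_eq_sum_map]
  simp [Measure.smul_apply, Measure.finsetSum_apply, Measure.map_apply (measurable_consSeq _) hE]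

lemma walkLaw_cylinder_pos [NeZero d] (ω : ℕ → Dir d) (N : ℕ) :
    0 < walkLaw d {ω' | ∀ k < N, ω' k = ω k} := by
  have : {ω' : ℕ → Dir d | ∀ k < N, ω' k = ω k} =
      Set.pi (Finset.range N : Set ℕ) (fun i => {ω i}) := by
    ext ω'; simp [Set.mem_pi]
  rw [this, walkLaw_pi_range, pos_iff_ne_zero, Finset.prod_ne_zero_iff]
  intro i _
  rw [uniformOn_univ]
  simpa using ENNReal.mul_ne_top (ENNReal.natCast_ne_top d) ENNReal.ofNat_ne_top

lemma walk_zero (x : Site d) (ω : ℕ → Dir d) : walk x ω 0 = x := by simp [walk]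

lemma walk_succ (x : Site d) (ω : ℕ → Dir d) (t : ℕ) :
    walk x ω (t + 1) = walk x ω t + stepVec (ω t) := by
  simp [walk, Finset.sum_range_succ, add_assoc]

lemma walk_consSeq_succ (x : Site d) (s : Dir d) (ω : ℕ → Dir d) (t : ℕ) :
    walk x (consSeq s ω) (t + 1) = walk (x + stepVec s) ω t := by
  induction t with
  | zero => simp [walk_succ, walk_zero, consSeq]
  | succ t ih => rw [walk_succ, ih, walk_succ]; rfl

lemma measurable_walk (x : Site d) (t : ℕ) : Measurable fun ω : ℕ → Dir d => walk x ω t := by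
  induction t with
  | zero => simp only [walk_zero]; exact measurable_const
  | succ t ih =>
    simp only [walk_succ]
    exact ih.add ((Measurable.of_discrete (f := (stepVec : Dir d → Site d))).comp
      (measurable_pi_apply t))

lemma measurableSet_walk_mem (x : Site d) (t : ℕ) (B : Set (Site d)) :
    MeasurableSet {ω : ℕ → Dir d | walk x ω t ∈ B} :=
  measurable_walk x t (Set.to_countable B).measurableSet

lemma walk_congr (x : Site d) {ω ω' : ℕ → Dir d} {t : ℕ} (h : ∀ k < t, ω' k = ω k) :
    walk x ω' t = walk x ω t := by
  simp only [walk]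
  congr 1
  exact Finset.sum_congr rfl fun k hk => by rw [h k (Finset.mem_range.1 hk)]

lemma measurableSet_hits (A : Finset (Site d)) (x : Site d) : MeasurableSet (hits A x) := by
  have : hits A x = ⋃ t, ⋃ _ : 1 ≤ t, {ω | walk x ω t ∈ (A : Set (Site d))} := by
    ext ω; simp [hits]
  rw [this]
  exact MeasurableSet.iUnion fun t => MeasurableSet.iUnion fun _ => measurableSet_walk_mem x t _

lemma consSeq_mem_hits {A : Finset (Site d)} {x : Site d} {s : Dir d} {ω : ℕ → Dir d} :
    consSeq s ω ∈ hits A x ↔ x + stepVec s ∈ A ∨ ω ∈ hits A (x + stepVec s) := by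
  simp only [hits, Set.mem_ofPred_eq]
  constructor
  · rintro ⟨t, ht, h⟩
    obtain ⟨t, rfl⟩ : ∃ u, t = u + 1 := ⟨t - 1, by omega⟩
    rw [walk_consSeq_succ] at h
    rcases Nat.eq_zero_or_pos t with rfl | h0
    · rw [walk_zero] at h; exact Or.inl h
    · exact Or.inr ⟨t, h0, h⟩
  · rintro (h | ⟨t, _, h⟩)
    · exact ⟨1, le_rfl, by rwa [walk_consSeq_succ, walk_zero]⟩
    · exact ⟨t + 1, by omega, by rwa [walk_consSeq_succ]⟩

/-- The event that the walk from `x` first visits `A` at `y`, at a time in `[1, T]`. -/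
def hitsAt (A : Finset (Site d)) (x y : Site d) (T : ℕ) : Set (ℕ → Dir d) :=
  {ω | ∃ t, 1 ≤ t ∧ t ≤ T ∧ walk x ω t = y ∧ ∀ k, 1 ≤ k → k < t → walk x ω k ∉ A}

lemma measurableSet_hitsAt (A : Finset (Site d)) (x y : Site d) (T : ℕ) :
    MeasurableSet (hitsAt A x y T) := by
  have : hitsAt A x y T = ⋃ t, ⋃ _ : 1 ≤ t, ⋃ _ : t ≤ T, ({ω | walk x ω t ∈ ({y} : Set (Site d))} ∩
      ⋂ k, ⋂ _ : 1 ≤ k, ⋂ _ : k < t, {ω | walk x ω k ∈ (A : Set (Site d))ᶜ}) := by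
    ext ω
    simp only [hitsAt, Set.mem_ofPred_eq, Set.mem_iUnion, Set.mem_inter_iff, Set.mem_iInter,
      Set.mem_singleton_iff, Set.mem_compl_iff, Finset.mem_coe, exists_prop]
  rw [this]
  exact MeasurableSet.iUnion fun t => MeasurableSet.iUnion fun _ => MeasurableSet.iUnion fun _ =>
    (measurableSet_walk_mem x t _).inter <| MeasurableSet.iInter fun k =>
      MeasurableSet.iInter fun _ => MeasurableSet.iInter fun _ => measurableSet_walk_mem x k _

lemma consSeq_mem_hitsAt {A : Finset (Site d)} {x y : Site d} {s : Dir d} {ω : ℕ → Dir d} {T : ℕ} :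
    consSeq s ω ∈ hitsAt A x y (T + 1) ↔
      x + stepVec s = y ∨ (x + stepVec s ∉ A ∧ ω ∈ hitsAt A (x + stepVec s) y T) := by
  simp only [hitsAt, Set.mem_ofPred_eq]
  constructor
  · rintro ⟨t, ht, htT, h, hk⟩
    obtain ⟨t, rfl⟩ : ∃ u, t = u + 1 := ⟨t - 1, by omega⟩
    rw [walk_consSeq_succ] at h
    rcases Nat.eq_zero_or_pos t with rfl | h0
    · rw [walk_zero] at h; exact Or.inl h
    · refine Or.inr ⟨?_, t, h0, by omega, h, fun k hk1 hk2 => ?_⟩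
      · have := hk 1 le_rfl (by omega)
        rwa [walk_consSeq_succ, walk_zero] at this
      · have := hk (k + 1) (by omega) (by omega)
        rwa [walk_consSeq_succ] at this
  · rintro (h | ⟨hA, t, h1, hT, h, hk⟩)
    · exact ⟨1, le_rfl, by omega, by rwa [walk_consSeq_succ, walk_zero], fun k _ _ => by omega⟩
    · refine ⟨t + 1, by omega, by omega, by rwa [walk_consSeq_succ], fun k hk1 hk2 => ?_⟩
      obtain ⟨k, rfl⟩ : ∃ u, k = u + 1 := ⟨k - 1, by omega⟩
      rw [walk_consSeq_succ]
      rcases Nat.eq_zero_or_pos k with rfl | h0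
      · rwa [walk_zero]
      · exact hk k h0 (by omega)

lemma hits_inter_eq_iUnion {A : Finset (Site d)} {x y : Site d} (hy : y ∈ A) :
    hits A x ∩ {ω | walk x ω (tau A x ω) = y} = ⋃ T, hitsAt A x y T := by
  ext ω
  simp only [Set.mem_inter_iff, Set.mem_ofPred_eq, Set.mem_iUnion]
  constructor
  · rintro ⟨h, hw⟩
    have hm := Nat.sInf_mem (s := {t | 1 ≤ t ∧ walk x ω t ∈ A}) h
    exact ⟨tau A x ω, tau A x ω, hm.1, le_rfl, hw, fun k h1 hk hA =>
      Nat.notMem_of_lt_sInf hk ⟨h1, hA⟩⟩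
  · rintro ⟨T, t, h1, -, hw, hk⟩
    have hmem : t ∈ {t | 1 ≤ t ∧ walk x ω t ∈ A} := ⟨h1, hw ▸ hy⟩
    have : tau A x ω = t := by
      refine le_antisymm (Nat.sInf_le hmem) (not_lt.1 fun hlt => ?_)
      have hm := Nat.sInf_mem (s := {t | 1 ≤ t ∧ walk x ω t ∈ A}) ⟨t, hmem⟩
      exact hk _ hm.1 hlt hm.2
    exact ⟨⟨t, hmem⟩, by rw [this, hw]⟩

/-! ### Hitting probabilities -/

lemma avg_mono {f g : Site d → ℝ≥0∞} (h : ∀ z, f z ≤ g z) (x : Site d) : avg f x ≤ avg g x := by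
  unfold avg
  gcongr
  exact h _

lemma avg_add (f g : Site d → ℝ≥0∞) (x : Site d) :
    avg (fun z => f z + g z) x = avg f x + avg g x := by
  simp [avg, Finset.sum_add_distrib, mul_add]

lemma avg_mul_const (f : Site d → ℝ≥0∞) (c : ℝ≥0∞) (x : Site d) :
    avg (fun z => f z * c) x = avg f x * c := by
  simp [avg, ← Finset.sum_mul, mul_assoc]

lemma avg_finset_sum {ι : Type*} (s : Finset ι) (f : ι → Site d → ℝ≥0∞) (x : Site d) :
    avg (fun z => ∑ i ∈ s, f i z) x = ∑ i ∈ s, avg (f i) x := by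
  simp only [avg, ← Finset.mul_sum]
  rw [Finset.sum_comm]

lemma avg_iSup {f : ℕ → Site d → ℝ≥0∞} (hf : Monotone f) (x : Site d) :
    avg (fun z => ⨆ n, f n z) x = ⨆ n, avg (f n) x := by
  simp only [avg, ← ENNReal.mul_iSup]
  rw [ENNReal.finsetSum_iSup_of_monotone]
  exact fun s m n h => hf h _

lemma avg_comm (F : Site d → Site d → ℝ≥0∞) (x y : Site d) :
    avg (fun z => avg (fun w => F z w) y) x = avg (fun w => avg (fun z => F z w) x) y := by
  simp only [avg, Finset.mul_sum]
  rw [Finset.sum_comm]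

lemma le_avg_of_step {f : Site d → ℝ≥0∞} (x : Site d) (s : Dir d) :
    (Fintype.card (Dir d) : ℝ≥0∞)⁻¹ * f (x + stepVec s) ≤ avg f x := by
  unfold avg
  gcongr
  exact Finset.single_le_sum (f := fun s => f (x + stepVec s)) (fun _ _ => zero_le) (Finset.mem_univ s)

lemma avg_pos_of_step [NeZero d] {f : Site d → ℝ≥0∞} {x : Site d} {s : Dir d}
    (h : 0 < f (x + stepVec s)) : 0 < avg f x :=
  (ENNReal.mul_pos (ENNReal.inv_ne_zero.2 card_dir_ne_top) h.ne').trans_le (le_avg_of_step x s)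

lemma exists_step_of_avg_pos {f : Site d → ℝ≥0∞} {x : Site d} (h : 0 < avg f x) :
    ∃ s, 0 < f (x + stepVec s) := by
  by_contra! hc
  have : avg f x = 0 := by
    simp [avg, fun s => le_antisymm (hc s) zero_le]
  exact h.ne' this

/-- The opposite direction. -/
def oppDir : Dir d ≃ Dir d := Equiv.prodCongr (Equiv.refl _) Equiv.boolNot

lemma stepVec_oppDir (s : Dir d) : stepVec (oppDir s) = -stepVec s := by
  rcases s with ⟨i, b⟩
  cases b <;> simp [oppDir, stepVec, ← Pi.single_neg]

lemma avg_indicator_comm (x y : Site d) :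
    avg (fun z => if z = y then 1 else 0) x = avg (fun z => if z = x then 1 else 0) y := by
  unfold avg
  congr 1
  refine Fintype.sum_equiv oppDir _ _ fun s => ?_
  rw [stepVec_oppDir]
  refine if_congr ?_ rfl rfl
  constructor
  · rintro rfl; abel
  · intro h; rw [← h]; abel

/-- `ℙ_x (τ_A ≤ T, S_{τ_A} = y)` for `y ∈ A`; for other `y`, the expected number of visits to `y`
of the walk from `x` in the time interval `[1, T]` before the return to `A`. -/
def hitApprox (A : Finset (Site d)) (y : Site d) : ℕ → Site d → ℝ≥0∞
  | 0, _ => 0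
  | T + 1, x => avg (fun z => (if z = y then 1 else 0) + if z ∈ A then 0 else hitApprox A y T z) x

/-- `ℙ_x (τ_A < ∞, S_{τ_A} = y)` for `y ∈ A`; for other `y`, the expected number of visits to `y`
of the walk from `x` at positive times before the return to `A`. -/
def hitKer (A : Finset (Site d)) (x y : Site d) : ℝ≥0∞ := ⨆ T, hitApprox A y T x

lemma hitApprox_mono (A : Finset (Site d)) (y : Site d) : Monotone (hitApprox A y) := by
  refine monotone_nat_of_le_succ fun T => ?_
  induction T with
  | zero => intro x; exact zero_le
  | succ T ih =>
    intro x
    refine avg_mono (fun z => ?_) x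
    gcongr
    split_ifs
    · exact le_rfl
    · exact ih z

lemma hitKer_eq_avg (A : Finset (Site d)) (x y : Site d) :
    hitKer A x y = avg (fun z => (if z = y then 1 else 0) + if z ∈ A then 0 else hitKer A z y) x := by
  have h1 : hitKer A x y = ⨆ T, hitApprox A y (T + 1) x :=
    (Monotone.iSup_nat_add (f := fun T => hitApprox A y T x)
      (fun m n h => hitApprox_mono A y h x) 1).symm
  rw [h1]
  simp only [hitApprox]
  rw [← avg_iSup]
  · congr 1
    ext z
    split_ifs <;> simp [hitKer, ENNReal.add_iSup]
  · intro m n h z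
    dsimp only
    gcongr
    split_ifs
    · exact le_rfl
    · exact hitApprox_mono A y h z

/-- The definition of `hitApprox` conditions on the first step of the path; conditioning on the last
step gives this recursion. The agreement of the two yields the symmetry of the kernel. -/
lemma hitApprox_right (A : Finset (Site d)) (T : ℕ) (x y : Site d) :
    hitApprox A y (T + 1) x =
      avg (fun z => (if z = x then 1 else 0) + if z ∈ A then 0 else hitApprox A z T x) y := by
  induction T generalizing x y with
  | zero => simp [hitApprox, avg_indicator_comm x y]
  | succ T ih =>
    rw [hitApprox, avg_add, avg_add, avg_indicator_comm]
    congr 1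
    conv_lhs => simp only [ih, avg_add]
    simp_rw [hitApprox]
    -- The case distinctions are pushed inside the inner averages, so that `avg_comm` can exchange
    -- the first and the last step.
    have e1 : ∀ z, (if z ∈ A then 0 else avg (fun z' => if z' = z then (1 : ℝ≥0∞) else 0) y +
          avg (fun w => if w ∈ A then 0 else hitApprox A w T z) y) =
        avg (fun w => (if z ∈ A then 0 else if w = z then (1 : ℝ≥0∞) else 0) +
          if z ∈ A then 0 else if w ∈ A then 0 else hitApprox A w T z) y := by
      intro z
      split_ifs with h
      · simp [avg]
      · rw [← avg_add]
    have e2 : ∀ w, (if w ∈ A then 0 else avg (fun z => (if z = w then (1 : ℝ≥0∞) else 0) +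
          if z ∈ A then 0 else hitApprox A w T z) x) =
        avg (fun z => (if w ∈ A then 0 else if z = w then (1 : ℝ≥0∞) else 0) +
          if w ∈ A then 0 else if z ∈ A then 0 else hitApprox A w T z) x := by
      intro w
      split_ifs with h
      · simp [avg]
      · rfl
    simp_rw [e1, e2]
    rw [avg_comm]
    congr 1
    ext w
    congr 1
    ext z
    by_cases hzw : z = w
    · subst hzw; simp
    · rw [if_neg hzw, if_neg (Ne.symm hzw)]
      split_ifs <;> simp

lemma hitApprox_symm (A : Finset (Site d)) (T : ℕ) (x y : Site d) :
    hitApprox A y T x = hitApprox A x T y := by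
  induction T generalizing x y with
  | zero => rfl
  | succ T ih =>
    rw [hitApprox_right, hitApprox]
    simp_rw [ih x]

lemma hitKer_symm (A : Finset (Site d)) (x y : Site d) : hitKer A x y = hitKer A y x := by
  simp only [hitKer, hitApprox_symm A _ x y]

/-- The expected number of visits to `y` at positive times of the walk from `x`. -/
def visits (x y : Site d) : ℝ≥0∞ := hitKer ∅ x y

lemma visits_eq_avg (x y : Site d) :
    visits x y = avg (fun z => (if z = y then 1 else 0) + visits z y) x := by
  rw [visits, hitKer_eq_avg]; simp [visits]

/-- Visits before the return to `A` are counted by `hitKer A x y`, those after it by the Green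
function from the return point `z`; a visit at the return itself is in the first term. Both
inequalities follow by induction on the time horizon. -/
lemma visits_le_first_visit (A : Finset (Site d)) (x y : Site d) :
    visits x y ≤ hitKer A x y + ∑ z ∈ A, hitKer A x z * visits z y := by
  refine iSup_le fun T => ?_
  induction T generalizing x with
  | zero => exact zero_le
  | succ T ih =>
    rw [hitApprox, hitKer_eq_avg A x y]
    simp_rw [hitKer_eq_avg A x, ← avg_mul_const, ← avg_finset_sum, ← avg_add]
    refine avg_mono (fun w => ?_) x
    rw [add_assoc]
    gcongr
    simp only [Finset.notMem_empty, if_false]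
    by_cases hw : w ∈ A
    · simp only [hw, if_true, zero_add, add_zero, ite_mul, one_mul, zero_mul,
        Finset.sum_ite_eq]
      exact le_iSup (fun T => hitApprox ∅ y T w) T
    · simp only [hw, if_false]
      refine (ih w).trans ?_
      gcongr
      exact self_le_add_left _ _

lemma first_visit_le_visits (A : Finset (Site d)) (x y : Site d) :
    hitKer A x y + ∑ z ∈ A, hitKer A x z * visits z y ≤ visits x y := by
  have key : ∀ T x, hitApprox A y T x + ∑ z ∈ A, hitApprox A z T x * visits z y ≤ visits x y := by
    intro T
    induction T with
    | zero => simp [hitApprox]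
    | succ T ih =>
      intro x
      rw [visits_eq_avg x]
      simp_rw [hitApprox, ← avg_mul_const, ← avg_finset_sum, ← avg_add]
      refine avg_mono (fun w => ?_) x
      rw [add_assoc]
      gcongr
      by_cases hw : w ∈ A
      · simp [hw]
      · simp only [hw, if_false]
        refine le_trans (le_of_eq ?_) (ih w)
        congr 1
        refine Finset.sum_congr rfl fun z hz => ?_
        rw [if_neg (by rintro rfl; exact hw hz), zero_add]
  simp only [hitKer, ENNReal.iSup_mul]
  rw [ENNReal.finsetSum_iSup_of_monotone, ENNReal.iSup_add_iSup_of_monotone]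
  · exact iSup_le fun T => key T x
  · exact fun m n h => hitApprox_mono A y h x
  · intro m n h
    dsimp only
    gcongr
    exact hitApprox_mono A _ h x
  · intro z m n h
    dsimp only
    gcongr
    exact hitApprox_mono A _ h x

lemma visits_eq_first_visit (A : Finset (Site d)) (x y : Site d) :
    visits x y = hitKer A x y + ∑ z ∈ A, hitKer A x z * visits z y :=
  (visits_le_first_visit A x y).antisymm (first_visit_le_visits A x y)

lemma hitKer_le_visits (A : Finset (Site d)) (x y : Site d) : hitKer A x y ≤ visits x y := by
  rw [visits_eq_first_visit A]; exact self_le_add_right _ _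

lemma walkLaw_hitsAt [NeZero d] {A : Finset (Site d)} {y : Site d} (hy : y ∈ A) (T : ℕ)
    (x : Site d) : walkLaw d (hitsAt A x y T) = hitApprox A y T x := by
  induction T generalizing x with
  | zero =>
    have : hitsAt A x y 0 = ∅ := by
      ext ω; simp only [hitsAt, Set.mem_ofPred_eq, Set.mem_empty_iff_false, iff_false]
      rintro ⟨t, h1, h2, -⟩; omega
    simp [this, hitApprox]
  | succ T ih =>
    rw [walkLaw_apply (measurableSet_hitsAt A x y _), hitApprox, avg]
    congr 1
    refine Finset.sum_congr rfl fun s _ => ?_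
    rw [← ih]
    have hpre : consSeq s ⁻¹' hitsAt A x y (T + 1) = {ω | x + stepVec s = y ∨
        (x + stepVec s ∉ A ∧ ω ∈ hitsAt A (x + stepVec s) y T)} :=
      Set.ext fun ω => consSeq_mem_hitsAt
    rw [hpre]
    by_cases h1 : x + stepVec s = y
    · simp [h1, hy]
    · by_cases h2 : x + stepVec s ∈ A
      · simp [h1, h2]
      · simp [h1, h2]

lemma walkLaw_hits_inter [NeZero d] {A : Finset (Site d)} {y : Site d} (hy : y ∈ A) (x : Site d) :
    walkLaw d (hits A x ∩ {ω | walk x ω (tau A x ω) = y}) = hitKer A x y := by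
  rw [hits_inter_eq_iUnion hy, Monotone.measure_iUnion]
  · simp only [walkLaw_hitsAt hy, hitKer]
  · rintro m n h ω ⟨t, h1, h2, h3⟩
    exact ⟨t, h1, h2.trans h, h3⟩

lemma walk_tau_mem {A : Finset (Site d)} {x : Site d} {ω : ℕ → Dir d} (h : ω ∈ hits A x) :
    1 ≤ tau A x ω ∧ walk x ω (tau A x ω) ∈ A :=
  Nat.sInf_mem (s := {t | 1 ≤ t ∧ walk x ω t ∈ A}) h

lemma walkLaw_hits [NeZero d] (A : Finset (Site d)) (x : Site d) :
    walkLaw d (hits A x) = ∑ y ∈ A, hitKer A x y := by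
  have : hits A x = ⋃ y ∈ A, (hits A x ∩ {ω | walk x ω (tau A x ω) = y}) := by
    ext ω
    simp only [Set.mem_iUnion]
    constructor
    · exact fun h => ⟨_, (walk_tau_mem h).2, h, rfl⟩
    · rintro ⟨_, _, h, _⟩; exact h
  conv_lhs => rw [this]
  rw [measure_biUnion_finset]
  · exact Finset.sum_congr rfl fun y hy => walkLaw_hits_inter hy x
  · intro y _ z _ hyz
    refine Set.disjoint_left.2 ?_
    rintro ω ⟨_, h1⟩ ⟨_, h2⟩
    exact hyz (h1.symm.trans h2)
  · intro y hy
    rw [hits_inter_eq_iUnion hy]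
    exact MeasurableSet.iUnion fun T => measurableSet_hitsAt A x y T

lemma hitProb_eq_div [NeZero d] {A : Finset (Site d)} {y : Site d} (hy : y ∈ A) (x : Site d) :
    hitProb A x y = hitKer A x y / ∑ z ∈ A, hitKer A x z := by
  rw [hitProb, cond_apply (measurableSet_hits A x), walkLaw_hits_inter hy, walkLaw_hits,
    ENNReal.div_eq_inv_mul]

lemma hitProb_eq_zero {A : Finset (Site d)} {y : Site d} (hy : y ∉ A) (x : Site d) :
    hitProb A x y = 0 := by
  rw [hitProb, cond_apply (measurableSet_hits A x)]
  have : hits A x ∩ {ω | walk x ω (tau A x ω) = y} = ∅ := by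
    ext ω
    simp only [Set.mem_inter_iff, Set.mem_ofPred_eq, Set.mem_empty_iff_false, iff_false, not_and]
    rintro h rfl
    exact hy (walk_tau_mem h).2
  simp [this]

/-- The probability that the walk from `x` does not return to `A`. -/
def escape (A : Finset (Site d)) (x : Site d) : ℝ≥0∞ := walkLaw d (hits A x)ᶜ

lemma escape_eq [NeZero d] (A : Finset (Site d)) (x : Site d) :
    escape A x = 1 - ∑ z ∈ A, hitKer A x z := by
  rw [escape, prob_compl_eq_one_sub (measurableSet_hits A x), walkLaw_hits]

lemma escape_eq_avg [NeZero d] (A : Finset (Site d)) (x : Site d) :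
    escape A x = avg (fun z => if z ∈ A then 0 else escape A z) x := by
  rw [escape, walkLaw_apply (measurableSet_hits A x).compl, avg]
  congr 1
  refine Finset.sum_congr rfl fun s _ => ?_
  have : consSeq s ⁻¹' (hits A x)ᶜ =
      {ω | x + stepVec s ∉ A ∧ ω ∉ hits A (x + stepVec s)} := by
    ext ω
    simp only [Set.mem_preimage, Set.mem_compl_iff, consSeq_mem_hits, not_or, Set.mem_ofPred_eq]
  rw [this]
  split_ifs with h
  · simp [h]
  · simp only [h, not_false_eq_true, true_and]; rfl

/-! ### Transience -/

/-- The squared Euclidean norm. -/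
def normSq (x : Site d) : ℝ := ∑ i, (x i : ℝ) ^ 2

lemma normSq_nonneg (x : Site d) : 0 ≤ normSq x := Finset.sum_nonneg fun _ _ => sq_nonneg _

lemma normSq_add_single (x : Site d) (i : Fin d) (c : ℤ) :
    normSq (x + Pi.single i c) = normSq x + 2 * c * x i + c ^ 2 := by
  have : ∀ j, (((x + Pi.single i c : Site d) j : ℤ) : ℝ) ^ 2 =
      (x j : ℝ) ^ 2 + if j = i then 2 * (c : ℝ) * x i + c ^ 2 else 0 := by
    intro j
    by_cases h : j = i
    · subst h; simp; ring
    · simp [h]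
  simp only [normSq, this, Finset.sum_add_distrib]
  simp; ring

lemma sq_le_normSq (x : Site d) (i : Fin d) : (x i : ℝ) ^ 2 ≤ normSq x :=
  Finset.single_le_sum (f := fun i => (x i : ℝ) ^ 2) (fun _ _ => sq_nonneg _) (Finset.mem_univ i)

/-- Opposite directions are paired: with `a = x i` and `q = normSq x`, a pair contributes `2 (q + 5)
/ ((q + 5) ^ 2 - 4 a ^ 2)`. In the correction to `2 / (q + 5)`, `a ^ 2 ≤ q` bounds the factor `(q +
5) ^ 2 - 4 a ^ 2` below by `q ^ 2 + 6 q + 25`. Summing `a ^ 2` to `q` leaves a polynomial inequality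
whose leading coefficients are `2 d ≥ 10` and `8`. -/
lemma sum_steps_inv_normSq_le (hd : 5 ≤ d) (x : Site d) :
    ∑ s : Dir d, 1 / (normSq (x + stepVec s) + 4) ≤ 2 * d / (normSq x + 4) := by
  have hd' : (5 : ℝ) ≤ d := by exact_mod_cast hd
  set q := normSq x with hq
  have hq0 : 0 ≤ q := normSq_nonneg x
  have hB : 0 < q ^ 2 + 6 * q + 25 := by positivity
  have hterm : ∀ i : Fin d, 1 / (normSq (x + stepVec (i, true)) + 4) +
      1 / (normSq (x + stepVec (i, false)) + 4) ≤
      2 / (q + 5) + (x i : ℝ) ^ 2 * (8 / ((q + 5) * (q ^ 2 + 6 * q + 25))) := by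
    intro i
    have hx := sq_le_normSq x i
    rw [← hq] at hx
    simp only [stepVec, if_true, Bool.false_eq_true, if_false, normSq_add_single, ← hq]
    push_cast
    set a := (x i : ℝ)
    have h1 : 0 < q + 5 + 2 * a := by nlinarith [sq_nonneg (a + 1)]
    have h2 : 0 < q + 5 - 2 * a := by nlinarith [sq_nonneg (a - 1)]
    have e : 1 / (q + 2 * 1 * a + 1 ^ 2 + 4) + 1 / (q + 2 * -1 * a + (-1) ^ 2 + 4) =
        2 / (q + 5) + a ^ 2 * (8 / ((q + 5) * ((q + 5 + 2 * a) * (q + 5 - 2 * a)))) := by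
      rw [show q + 2 * 1 * a + 1 ^ 2 + 4 = q + 5 + 2 * a by ring,
        show q + 2 * -1 * a + (-1) ^ 2 + 4 = q + 5 - 2 * a by ring]
      field_simp
      ring
    rw [e]
    gcongr
    nlinarith
  rw [Fintype.sum_prod_type]
  simp only [Fintype.sum_bool]
  refine (Finset.sum_le_sum fun i _ => hterm i).trans ?_
  rw [Finset.sum_add_distrib, ← Finset.sum_mul]
  have : ∑ i, (x i : ℝ) ^ 2 = q := rfl
  rw [this]
  simp only [Finset.sum_const, Finset.card_univ, Fintype.card_fin, nsmul_eq_mul]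
  have : 2 * (d : ℝ) / (q + 4) - (d * (2 / (q + 5)) + q * (8 / ((q + 5) * (q ^ 2 + 6 * q + 25)))) =
      (2 * d * (q ^ 2 + 6 * q + 25) - 8 * q * (q + 4)) /
        ((q + 4) * (q + 5) * (q ^ 2 + 6 * q + 25)) := by
    field_simp
    ring
  have h3 : 0 ≤ (2 * d * (q ^ 2 + 6 * q + 25) - 8 * q * (q + 4)) /
        ((q + 4) * (q + 5) * (q ^ 2 + 6 * q + 25)) := by
    apply div_nonneg _ (by positivity)
    nlinarith [mul_le_mul_of_nonneg_right hd' hB.le]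
  linarith

/-- A superharmonic function vanishing at infinity; it bounds the Green function. -/
def greenBound (x : Site d) : ℝ≥0∞ := ENNReal.ofReal (20 / (normSq x + 4))

lemma normSq_zero : normSq (0 : Site d) = 0 := by simp [normSq]

lemma normSq_stepVec (s : Dir d) : normSq (stepVec s) = 1 := by
  have := normSq_add_single (0 : Site d) s.1 (if s.2 then 1 else -1)
  rw [zero_add, normSq_zero] at this
  rw [stepVec, this]
  split_ifs <;> simp

/-- The constant 20 gives equality at the origin: `20 / 4 = 1 + 20 / 5`. -/
lemma avg_greenBound_le (hd : 5 ≤ d) (x : Site d) :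
    (if x = 0 then 1 else 0) + avg greenBound x ≤ greenBound x := by
  have hdpos : (0 : ℝ) < 2 * d := by positivity
  have hcard : (Fintype.card (Dir d) : ℝ≥0∞)⁻¹ = ENNReal.ofReal (2 * (d : ℝ))⁻¹ := by
    rw [ENNReal.ofReal_inv_of_pos hdpos]
    congr 1
    rw [ENNReal.ofReal_mul (by norm_num)]
    simp [mul_comm]
  have hnn : ∀ x : Site d, 0 ≤ 20 / (normSq x + 4) := fun x => by
    have := normSq_nonneg x; positivity
  have havg : avg greenBound x =
      ENNReal.ofReal ((2 * (d : ℝ))⁻¹ * ∑ s : Dir d, 20 / (normSq (x + stepVec s) + 4)) := by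
    rw [avg, hcard, ENNReal.ofReal_mul (by positivity),
      ENNReal.ofReal_sum_of_nonneg fun s _ => hnn _]
    rfl
  have hδ : (if x = 0 then (1 : ℝ≥0∞) else 0) = ENNReal.ofReal (if x = 0 then 1 else 0) := by
    split_ifs <;> simp
  rw [havg, hδ, ← ENNReal.ofReal_add (by split_ifs <;> norm_num)
    (mul_nonneg (by positivity) (Finset.sum_nonneg fun s _ => hnn _))]
  refine ENNReal.ofReal_le_ofReal ?_
  split_ifs with h
  · subst h
    simp only [zero_add, normSq_stepVec, normSq_zero, Finset.sum_const, Finset.card_univ,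
      nsmul_eq_mul, Fintype.card_prod, Fintype.card_fin, Fintype.card_bool]
    push_cast
    field_simp
    norm_num
  · have := sum_steps_inv_normSq_le hd x
    have e : ∀ y : Site d, 20 / (normSq y + 4) = 20 * (1 / (normSq y + 4)) := fun y => by ring
    simp only [e, ← Finset.mul_sum]
    rw [zero_add, inv_mul_le_iff₀ hdpos]
    calc _ ≤ 20 * (2 * (d : ℝ) / (normSq x + 4)) := by gcongr
      _ = _ := by ring

lemma visits_le_greenBound (hd : 5 ≤ d) (x y : Site d) : visits x y ≤ greenBound (x - y) := by
  have key : ∀ T x, (if x = y then 1 else 0) + hitApprox ∅ y T x ≤ greenBound (x - y) := by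
    intro T
    induction T with
    | zero =>
      intro x
      refine le_trans ?_ (avg_greenBound_le hd (x - y))
      simp only [hitApprox, sub_eq_zero]
      gcongr
      exact zero_le
    | succ T ih =>
      intro x
      refine le_trans ?_ (avg_greenBound_le hd (x - y))
      simp only [sub_eq_zero]
      gcongr
      rw [hitApprox]
      refine (avg_mono (g := fun z => greenBound (z - y)) (fun z => ?_) x).trans (le_of_eq ?_)
      · simpa using ih z
      · simp only [avg, add_sub_right_comm]
  exact iSup_le fun T => le_trans (self_le_add_left _ _) (key T x)

lemma visits_ne_top (hd : 5 ≤ d) (x y : Site d) : visits x y ≠ ∞ :=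
  ne_top_of_le_ne_top ENNReal.ofReal_ne_top (visits_le_greenBound hd x y)

lemma finite_normSq_le (R : ℝ) : {x : Site d | normSq x ≤ R}.Finite := by
  obtain ⟨N, hN⟩ := exists_nat_ge R
  refine (Set.finite_Icc (fun _ : Fin d => -(N : ℤ)) (fun _ => (N : ℤ))).subset fun x hx => ?_
  have h : ∀ i, |x i| ≤ N := fun i => by
    have h1 : (x i : ℝ) ^ 2 ≤ N := (sq_le_normSq x i).trans (le_trans hx hN)
    have h2 : (x i) ^ 2 ≤ (N : ℤ) := by exact_mod_cast h1
    rcases abs_cases (x i) with ⟨h, _⟩ | ⟨h, _⟩ <;> rw [h] <;> nlinarith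
  exact ⟨fun i => (abs_le.1 (h i)).1, fun i => (abs_le.1 (h i)).2⟩

lemma tendsto_greenBound : Tendsto (greenBound : Site d → ℝ≥0∞) cofinite (𝓝 0) := by
  have h1 : Tendsto (normSq : Site d → ℝ) cofinite atTop := by
    refine tendsto_atTop.2 fun R => ?_
    refine (finite_normSq_le (d := d) R).subset fun x hx => ?_
    simp only [Set.mem_compl_iff, Set.mem_ofPred_eq, not_le] at hx ⊢
    exact hx.le
  have h2 : Tendsto (fun x : Site d => 20 / (normSq x + 4)) cofinite (𝓝 0) :=
    (tendsto_atTop_add_const_right _ 4 h1).const_div_atTop 20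
  have h3 := ENNReal.tendsto_ofReal h2
  rwa [ENNReal.ofReal_zero] at h3

lemma tendsto_visits_zero (hd : 5 ≤ d) (y : Site d) :
    Tendsto (fun x => visits x y) cofinite (𝓝 0) :=
  tendsto_of_tendsto_of_tendsto_of_le_of_le tendsto_const_nhds
    (tendsto_greenBound.comp (sub_left_injective (b := y)).tendsto_cofinite)
    (fun _ => zero_le) (fun x => visits_le_greenBound hd x y)

/-! ### Positive harmonic functions -/

/-- The shifts that preserve `P` form a submonoid, and the signed unit vectors generate `ℤ^d` as a
monoid. -/
lemma step_induction {P : Site d → Prop} (y : Site d) (h0 : P y)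
    (hs : ∀ x s, P x → P (x + stepVec s)) (x : Site d) : P x := by
  let M : AddSubmonoid (Site d) :=
    { carrier := {x | ∀ y, P y → P (y + x)}
      zero_mem' := fun y h => by simpa using h
      add_mem' := fun {a b} ha hb y h => by rw [← add_assoc]; exact hb _ (ha _ h) }
  have hstep : ∀ s : Dir d, stepVec s ∈ M := fun s y h => hs y s h
  have hsingle : ∀ (i : Fin d) (k : ℤ), (Pi.single i k : Site d) ∈ M := by
    intro i k
    have hsm : (Pi.single i k : Site d) = k.natAbs • stepVec (i, decide (0 ≤ k)) := by
      rw [stepVec, ← Pi.single_smul]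
      congr 1
      rcases le_or_gt 0 k with h | h
      · simp [h, abs_of_nonneg h]
      · simp [h.not_ge, abs_of_neg h]
    rw [hsm]
    exact M.nsmul_mem (hstep _) _
  have hx : ∀ x : Site d, x ∈ M := fun x => by
    rw [← Finset.univ_sum_single x]
    exact M.sum_mem fun i _ => hsingle i _
  simpa using hx (x - y) y h0

/-- Harnack inequality with a constant that depends on the shift alone. Only the one-step bound is
assumed, so that it applies to the Green function, which is not harmonic everywhere. -/
lemma exists_harnack_const (z : Site d) : ∃ C : ℝ, ∀ h : Site d → ℝ, (∀ x, 0 ≤ h x) →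
    (∀ x s, h (x + stepVec s) ≤ Fintype.card (Dir d) * h x) → ∀ x, h (x + z) ≤ C * h x := by
  refine step_induction (P := fun z => ∃ C : ℝ, ∀ h : Site d → ℝ, (∀ x, 0 ≤ h x) →
    (∀ x s, h (x + stepVec s) ≤ Fintype.card (Dir d) * h x) → ∀ x, h (x + z) ≤ C * h x) 0
    ⟨1, by simp⟩ ?_ z
  rintro z s ⟨C, hC⟩
  refine ⟨Fintype.card (Dir d) * C, fun h h0 hs x => ?_⟩
  rw [← add_assoc]
  refine (hs _ s).trans ?_
  rw [mul_assoc]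
  gcongr
  exact hC h h0 hs x

/-- The nonnegative harmonic functions on `ℤ^d` with value `1` at the origin. -/
def harmonicBase (d : ℕ) : Set (Site d → ℝ) :=
  {h | (∀ x, 0 ≤ h x) ∧ h 0 = 1 ∧ ∀ x, ∑ s, h (x + stepVec s) = Fintype.card (Dir d) * h x}

lemma harmonicBase_step {h : Site d → ℝ} (hh : h ∈ harmonicBase d) (x : Site d) (s : Dir d) :
    h (x + stepVec s) ≤ Fintype.card (Dir d) * h x := by
  rw [← hh.2.2]
  exact Finset.single_le_sum (f := fun s => h (x + stepVec s)) (fun _ _ => hh.1 _) (Finset.mem_univ s)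

lemma harmonicBase_pos {h : Site d → ℝ} (hh : h ∈ harmonicBase d) (x : Site d) : 0 < h x := by
  obtain ⟨C, hC⟩ := exists_harnack_const (-x)
  have := hC h hh.1 (harmonicBase_step hh) x
  rw [add_neg_cancel, hh.2.1] at this
  exact (hh.1 x).lt_of_ne fun h0 => by rw [← h0] at this; norm_num at this

lemma isCompact_harmonicBase : IsCompact (harmonicBase d) := by
  choose C hC using exists_harnack_const (d := d)
  have hsub : harmonicBase d ⊆ Set.pi Set.univ fun x => Set.Icc 0 (C x) := by
    intro h hh x _
    have := hC x h hh.1 (harmonicBase_step hh) 0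
    rw [zero_add, hh.2.1, mul_one] at this
    exact ⟨hh.1 x, this⟩
  refine (isCompact_univ_pi fun x => isCompact_Icc).of_isClosed_subset ?_ hsub
  have : harmonicBase d = (⋂ x, {h | 0 ≤ h x}) ∩ ({h | h 0 = 1} ∩
      ⋂ x, {h | ∑ s, h (x + stepVec s) = (Fintype.card (Dir d) : ℝ) * h x}) := by
    ext h; simp [harmonicBase]
  rw [this]
  refine (isClosed_iInter fun x => ?_).inter (IsClosed.inter ?_ (isClosed_iInter fun x => ?_))
  · exact isClosed_le continuous_const (continuous_apply x)
  · exact isClosed_eq (continuous_apply _) continuous_const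
  · exact isClosed_eq (by fun_prop) (by fun_prop)

lemma convex_harmonicBase : Convex ℝ (harmonicBase d) := by
  intro f hf g hg a b ha hb hab
  refine ⟨fun x => ?_, ?_, fun x => ?_⟩
  · have := hf.1 x
    have := hg.1 x
    simp only [Pi.add_apply, Pi.smul_apply, smul_eq_mul]
    positivity
  · simp [hf.2.1, hg.2.1, hab]
  · simp only [Pi.add_apply, Pi.smul_apply, smul_eq_mul, Finset.sum_add_distrib, ← Finset.mul_sum,
      hf.2.2, hg.2.2]
    ring

lemma oppDir_ne (s : Dir d) : oppDir s ≠ s := by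
  rcases s with ⟨i, b⟩
  cases b <;> simp [oppDir]

/-- By the mean value property, `h` is a convex combination of its normalized translate by `stepVec
s` and of a normalized remainder. The weight `w = h (stepVec s) / c` is less than 1 because the
opposite direction also contributes to the mean at the origin. Extremality makes the translate equal
to `h`. -/
lemma extremePoint_add_step {h : Site d → ℝ} (hh : h ∈ (harmonicBase d).extremePoints ℝ)
    (s : Dir d) (x : Site d) : h (x + stepVec s) = h (stepVec s) * h x := by
  rw [mem_extremePoints_iff_left] at hh
  obtain ⟨hK, hext⟩ := hh
  have hpos := harmonicBase_pos hK
  have hsp := hpos (stepVec s)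
  set c : ℝ := (Fintype.card (Dir d) : ℝ) with hc
  have hlt : h (stepVec s) < c := by
    have := hK.2.2 0
    rw [hK.2.1, mul_one] at this
    rw [hc, ← this]
    simp only [zero_add]
    exact Finset.single_lt_sum (oppDir_ne s) (Finset.mem_univ _) (Finset.mem_univ _) (hpos _)
      fun _ _ _ => hK.1 _
  have hcp : 0 < c := hsp.trans hlt
  set w := h (stepVec s) / c with hw
  have hw0 : 0 < w := by positivity
  have hw1 : 0 < 1 - w := by rw [hw, sub_pos, div_lt_one hcp]; exact hlt
  have hc0 := hcp.ne'
  have hs0 := hsp.ne'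
  have h1 : (fun x => h (x + stepVec s) / h (stepVec s)) ∈ harmonicBase d := by
    refine ⟨fun x => div_nonneg (hK.1 _) hsp.le, by simp [hs0], fun x => ?_⟩
    simp only [add_right_comm x _ (stepVec s)]
    rw [← Finset.sum_div, hK.2.2, mul_div_assoc]
  have h2 : (fun x => (h x - h (x + stepVec s) / c) / (1 - w)) ∈ harmonicBase d := by
    refine ⟨fun x => div_nonneg ?_ hw1.le, ?_, fun x => ?_⟩
    · rw [sub_nonneg, div_le_iff₀ hcp, mul_comm]
      exact harmonicBase_step hK x s
    · simp only [zero_add, hK.2.1]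
      exact div_self hw1.ne'
    · simp only [add_right_comm x _ (stepVec s)]
      rw [← Finset.sum_div, Finset.sum_sub_distrib, ← Finset.sum_div, hK.2.2, hK.2.2]
      ring
  have := hext _ h1 _ h2 ⟨w, 1 - w, hw0, hw1, by ring, ?_⟩
  · have : h (x + stepVec s) / h (stepVec s) = h x := congrFun this x
    rw [div_eq_iff hs0] at this
    rw [this, mul_comm]
  · ext x
    simp only [Pi.add_apply, Pi.smul_apply, smul_eq_mul]
    rw [mul_div_cancel₀ _ hw1.ne', hw]
    field_simp
    ring

/-- Multiplicativity gives `h (e) * h (-e) = 1`, hence `h (e) + h (-e) ≥ 2`. Harmonicity at the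
origin forces equality in all these inequalities. -/
lemma extremePoint_eq_one {h : Site d → ℝ} (hh : h ∈ (harmonicBase d).extremePoints ℝ) :
    h = fun _ => 1 := by
  have hmul := extremePoint_add_step hh
  have hK := hh.1
  have hpos := harmonicBase_pos hK
  have hinv : ∀ s : Dir d, h (stepVec s) * h (stepVec (oppDir s)) = 1 := fun s => by
    rw [← hmul, stepVec_oppDir, neg_add_cancel, hK.2.1]
  have hge : ∀ s : Dir d, 0 ≤ h (stepVec s) + h (stepVec (oppDir s)) - 2 := fun s => by
    nlinarith [hinv s, hpos (stepVec s), hpos (stepVec (oppDir s)),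
      sq_nonneg (h (stepVec s) - h (stepVec (oppDir s)))]
  have hsum : ∑ s : Dir d, h (stepVec s) = Fintype.card (Dir d) := by
    simpa [hK.2.1] using hK.2.2 0
  have hsum' : ∑ s : Dir d, h (stepVec (oppDir s)) = Fintype.card (Dir d) := by
    rw [← hsum]; exact Equiv.sum_comp oppDir fun s => h (stepVec s)
  have hzero : ∑ s : Dir d, (h (stepVec s) + h (stepVec (oppDir s)) - 2) = 0 := by
    rw [Finset.sum_sub_distrib, Finset.sum_add_distrib, hsum, hsum']
    simp; ring
  have hone : ∀ s : Dir d, h (stepVec s) = 1 := fun s => by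
    have h2 := (Finset.sum_eq_zero_iff_of_nonneg fun s _ => hge s).1 hzero s (Finset.mem_univ s)
    nlinarith [hinv s, sq_nonneg (h (stepVec s) - 1)]
  ext x
  refine step_induction (P := fun x => h x = 1) 0 hK.2.1 (fun x s hx => ?_) x
  rw [hmul, hone, hx, one_mul]

theorem harmonicBase_eq_one {h : Site d → ℝ} (hh : h ∈ harmonicBase d) : h = fun _ => 1 := by
  rw [← closure_convexHull_extremePoints isCompact_harmonicBase convex_harmonicBase] at hh
  have hsub : closure (convexHull ℝ ((harmonicBase d).extremePoints ℝ)) ⊆ {fun _ => 1} :=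
    closure_minimal (convexHull_min (fun h hh => extremePoint_eq_one hh) (convex_singleton _))
      isClosed_singleton
  exact hsub hh

/-! ### The ratio limit theorem for the Green function -/

lemma inv_card_mul_visits_le (w x : Site d) (s : Dir d) :
    (Fintype.card (Dir d) : ℝ≥0∞)⁻¹ * visits (w + stepVec s) x ≤ visits w x := by
  conv_rhs => rw [visits_eq_avg]
  refine le_trans ?_ (le_avg_of_step w s)
  gcongr
  exact self_le_add_left _ _

lemma visits_pos [NeZero d] (w x : Site d) : 0 < visits w x := by
  have hc : (Fintype.card (Dir d) : ℝ≥0∞)⁻¹ ≠ 0 := ENNReal.inv_ne_zero.2 card_dir_ne_top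
  have s0 : Dir d := (0, true)
  have hback : ∀ w (s : Dir d), 0 < visits w x → 0 < visits (w + stepVec s) x := by
    intro w s h
    refine (ENNReal.mul_pos hc h.ne').trans_le ?_
    have := inv_card_mul_visits_le (w + stepVec s) x (oppDir s)
    rwa [stepVec_oppDir, add_neg_cancel_right] at this
  have h1 : 0 < visits (x + stepVec s0) x := by
    rw [visits_eq_avg]
    refine avg_pos_of_step (s := oppDir s0) ?_
    rw [stepVec_oppDir, add_neg_cancel_right, if_pos rfl]
    exact lt_of_lt_of_le one_pos (self_le_add_right _ _)
  exact step_induction (P := fun w => 0 < visits w x) _ h1 hback w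

lemma visits_eq_avg_visits {w x : Site d} (h : ∀ s : Dir d, w + stepVec s ≠ x) :
    visits w x = avg (fun z => visits z x) w := by
  rw [visits_eq_avg, avg_add]
  simp [avg, h]

lemma sum_visits_toReal [NeZero d] (hd : 5 ≤ d) {w x : Site d} (h : ∀ s : Dir d, w + stepVec s ≠ x) :
    ∑ s : Dir d, (visits (w + stepVec s) x).toReal =
      Fintype.card (Dir d) * (visits w x).toReal := by
  rw [visits_eq_avg_visits h, avg, ENNReal.toReal_mul, ENNReal.toReal_inv,
    ENNReal.toReal_sum fun s _ => visits_ne_top hd _ _, ENNReal.toReal_natCast]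
  have : (Fintype.card (Dir d) : ℝ) ≠ 0 := by exact_mod_cast Fintype.card_ne_zero
  field_simp

lemma visits_toReal_step [NeZero d] (hd : 5 ≤ d) (w x : Site d) (s : Dir d) :
    (visits (w + stepVec s) x).toReal ≤ Fintype.card (Dir d) * (visits w x).toReal := by
  have := ENNReal.toReal_mono (visits_ne_top hd w x) (inv_card_mul_visits_le w x s)
  rw [ENNReal.toReal_mul, ENNReal.toReal_inv, ENNReal.toReal_natCast] at this
  rwa [inv_mul_le_iff₀ (by exact_mod_cast Fintype.card_pos)] at this

/-- Along an ultrafilter all the ratios converge at once, being bounded by Harnack; the limit lies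
in `harmonicBase d`, so it is the constant 1. -/
theorem tendsto_visits_ratio_toReal [NeZero d] (hd : 5 ≤ d) (w : Site d) :
    Tendsto (fun x => (visits w x).toReal / (visits 0 x).toReal) cofinite (𝓝 1) := by
  rw [tendsto_iff_ultrafilter]
  intro g hg
  have hpos : ∀ x : Site d, 0 < (visits 0 x).toReal := fun x =>
    ENNReal.toReal_pos (visits_pos 0 x).ne' (visits_ne_top hd 0 x)
  set ρ : Site d → Site d → ℝ := fun w x => (visits w x).toReal / (visits 0 x).toReal with hρ
  have hlim : ∀ w, ∃ l, Tendsto (ρ w) g (𝓝 l) := by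
    intro w
    obtain ⟨C, hC⟩ := exists_harnack_const w
    have hmem : ∀ x, ρ w x ∈ Set.Icc 0 C := fun x => by
      refine ⟨div_nonneg ENNReal.toReal_nonneg ENNReal.toReal_nonneg, ?_⟩
      rw [hρ, div_le_iff₀ (hpos x)]
      simpa using hC (fun w => (visits w x).toReal) (fun _ => ENNReal.toReal_nonneg)
        (fun w s => visits_toReal_step hd w x s) 0
    obtain ⟨l, -, hl⟩ := (isCompact_Icc (a := (0 : ℝ)) (b := C)).ultrafilter_le_nhds (g.map (ρ w))
      (le_principal_iff.2 (Ultrafilter.mem_map.2 (univ_mem' hmem)))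
    exact ⟨l, hl⟩
  choose h hh using hlim
  have hmem : h ∈ harmonicBase d := by
    refine ⟨fun w => ?_, ?_, fun w => ?_⟩
    · exact ge_of_tendsto (hh w) (Eventually.of_forall fun x =>
        div_nonneg ENNReal.toReal_nonneg ENNReal.toReal_nonneg)
    · refine tendsto_nhds_unique (hh 0) ?_
      have : ρ 0 = fun _ => 1 := funext fun x => div_self (hpos x).ne'
      rw [this]
      exact tendsto_const_nhds
    · refine tendsto_nhds_unique (tendsto_finsetSum Finset.univ fun s _ => hh (w + stepVec s)) ?_
      refine ((hh w).const_mul (Fintype.card (Dir d) : ℝ)).congr' ?_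
      refine hg ?_
      -- Since `visits` omits time 0, the mean value property at `w` can fail only if `x` is a
      -- neighbor of `w`, which excludes finitely many `x`.
      have hfin : (Set.range fun s : Dir d => w + stepVec s).Finite := Set.finite_range _
      filter_upwards [hfin.compl_mem_cofinite] with x hx
      have := sum_visits_toReal hd (w := w) (x := x) fun s hs => hx ⟨s, hs⟩
      simp only [hρ]
      rw [← Finset.sum_div, this, mul_div_assoc]
  have := hh w
  rwa [harmonicBase_eq_one hmem] at this

theorem tendsto_visits_ratio [NeZero d] (hd : 5 ≤ d) (w : Site d) :
    Tendsto (fun x => visits w x / visits 0 x) cofinite (𝓝 1) := by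
  have := ENNReal.tendsto_ofReal (tendsto_visits_ratio_toReal hd w)
  rw [ENNReal.ofReal_one] at this
  refine this.congr fun x => ?_
  rw [ENNReal.ofReal_div_of_pos (ENNReal.toReal_pos (visits_pos 0 x).ne' (visits_ne_top hd 0 x)),
    ENNReal.ofReal_toReal (visits_ne_top hd _ _), ENNReal.ofReal_toReal (visits_ne_top hd _ _)]

/-! ### Paths and exterior points -/

lemma adj_comm {x y : Site d} : Adj x y ↔ Adj y x := by
  simp only [Adj, abs_sub_comm]

lemma adj_add_stepVec (x : Site d) (s : Dir d) : Adj x (x + stepVec s) := by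
  have : ∀ i, |x i - (x + stepVec s) i| = if i = s.1 then 1 else 0 := by
    intro i
    by_cases h : i = s.1
    · subst h
      rcases s with ⟨i, b⟩
      cases b <;> simp [stepVec]
    · simp [stepVec, h]
  rw [Adj, Finset.sum_congr rfl fun i _ => this i]
  simp

lemma adj_iff_exists_step {x y : Site d} : Adj x y ↔ ∃ s, y = x + stepVec s := by
  constructor
  · intro h
    obtain ⟨i, hi⟩ : ∃ i, x i ≠ y i := by
      by_contra! hc
      simp [Adj, hc] at h
    have h1 : 1 ≤ |x i - y i| := Int.one_le_abs (sub_ne_zero.2 hi)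
    have hsplit := Finset.add_sum_erase Finset.univ (fun j => |x j - y j|) (Finset.mem_univ i)
    rw [Adj] at h
    have hnn : 0 ≤ ∑ j ∈ Finset.univ.erase i, |x j - y j| :=
      Finset.sum_nonneg fun _ _ => abs_nonneg _
    have h2 : |x i - y i| = 1 := by
      omega
    have h3 : ∑ j ∈ Finset.univ.erase i, |x j - y j| = 0 := by
      omega
    have h4 : ∀ j, j ≠ i → y j = x j := fun j hj => by
      have := (Finset.sum_eq_zero_iff_of_nonneg fun _ _ => abs_nonneg _).1 h3 j
        (Finset.mem_erase.2 ⟨hj, Finset.mem_univ _⟩)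
      rw [abs_eq_zero] at this; omega
    refine ⟨(i, decide (x i < y i)), funext fun j => ?_⟩
    by_cases hj : j = i
    · subst hj
      by_cases hlt : x j < y j
      · simp only [stepVec, hlt, decide_true, if_true, Pi.add_apply, Pi.single_eq_same]
        rw [abs_of_neg (by omega)] at h2; omega
      · simp only [stepVec, hlt, decide_false, Bool.false_eq_true, if_false, Pi.add_apply,
          Pi.single_eq_same]
        rw [abs_of_pos (by omega)] at h2; omega
    · simp [stepVec, hj, h4 j hj]
  · rintro ⟨s, rfl⟩
    exact adj_add_stepVec x s

/-- There is a path from `x` to `z` which avoids `A` after its starting point. -/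
def Conn (A : Finset (Site d)) : Site d → Site d → Prop :=
  Relation.ReflTransGen fun a b => Adj a b ∧ b ∉ A

/-- `x` is in an infinite component of the complement of `A`. -/
def Ext (A : Finset (Site d)) (x : Site d) : Prop := x ∉ A ∧ {z | Conn A x z}.Infinite

lemma Conn.mono {A B : Finset (Site d)} (h : A ⊆ B) {x y : Site d} (hc : Conn B x y) :
    Conn A x y := by
  induction hc with
  | refl => exact Relation.ReflTransGen.refl
  | tail _ hbc ih => exact Relation.ReflTransGen.tail ih ⟨hbc.1, fun hA => hbc.2 (h hA)⟩

lemma Conn.trans {A : Finset (Site d)} {x y z : Site d} (h₁ : Conn A x y) (h₂ : Conn A y z) :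
    Conn A x z := Relation.ReflTransGen.trans h₁ h₂

lemma Conn.notMem {A : Finset (Site d)} {x y : Site d} (hx : x ∉ A) (h : Conn A x y) : y ∉ A := by
  rcases Relation.ReflTransGen.cases_tail h with rfl | ⟨_, _, h⟩
  · exact hx
  · exact h.2

lemma Conn.symm {A : Finset (Site d)} {x y : Site d} (hx : x ∉ A) (h : Conn A x y) :
    Conn A y x := by
  induction h with
  | refl => exact Relation.ReflTransGen.refl
  | tail hab hbc ih =>
    exact Relation.ReflTransGen.head ⟨adj_comm.1 hbc.1, Conn.notMem hx hab⟩ ih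

lemma Ext.of_conn {A : Finset (Site d)} {x y : Site d} (hx : Ext A x) (h : Conn A x y) :
    Ext A y :=
  ⟨h.notMem hx.1, hx.2.mono fun _ hz => (h.symm hx.1).trans hz⟩

/-- The path may come back to `x`; what follows its last visit to `x` avoids all of `A`. -/
lemma Conn.of_erase {A : Finset (Site d)} {x z : Site d} (h : Conn (A.erase x) x z) :
    z = x ∨ Conn A x z := by
  induction h with
  | refl => exact Or.inl rfl
  | @tail b c _ hbc ih =>
    by_cases hc : c = x
    · exact Or.inl hc
    · have hcA : c ∉ A := fun h => hbc.2 (Finset.mem_erase.2 ⟨hc, h⟩)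
      rcases ih with rfl | ih
      · exact Or.inr (Relation.ReflTransGen.single ⟨hbc.1, hcA⟩)
      · exact Or.inr (Relation.ReflTransGen.tail ih ⟨hbc.1, hcA⟩)

lemma infinite_conn_iff_ext_erase {A : Finset (Site d)} {x : Site d} :
    {z | Conn A x z}.Infinite ↔ Ext (A.erase x) x := by
  constructor
  · exact fun h => ⟨Finset.notMem_erase x A, h.mono fun z hz => Conn.mono (Finset.erase_subset _ _) hz⟩
  · intro h hf
    refine h.2 ((hf.insert x).subset fun z hz => ?_)
    exact Conn.of_erase hz

lemma reflTransGen_ray {P : Site d → Prop} {x : Site d} (s : Dir d) (n : ℕ)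
    (h : ∀ k < n, P (x + (k + 1) • stepVec s)) :
    Relation.ReflTransGen (fun a b => Adj a b ∧ P b) x (x + n • stepVec s) := by
  induction n with
  | zero => rw [zero_nsmul, add_zero]
  | succ n ih =>
    refine Relation.ReflTransGen.tail (ih fun k hk => h k (by omega)) ⟨?_, h n (by omega)⟩
    rw [succ_nsmul, ← add_assoc]
    exact adj_add_stepVec _ _

lemma stepVec_apply_ne_zero (s : Dir d) : stepVec s s.1 ≠ 0 := by
  simp only [stepVec, Pi.single_eq_same]; split_ifs <;> norm_num

lemma infinite_conn_of_ray {A : Finset (Site d)} {x : Site d} (s : Dir d)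
    (h : ∀ k : ℕ, x + (k + 1) • stepVec s ∉ A) : {z | Conn A x z}.Infinite := by
  refine Set.infinite_of_injective_forall_mem (f := fun k : ℕ => x + k • stepVec s) ?_
    (fun k => reflTransGen_ray s k fun l _ => h l)
  intro k l hkl
  have h1 := congrFun (add_left_cancel hkl) s.1
  simp only [Pi.smul_apply, nsmul_eq_mul] at h1
  exact_mod_cast mul_right_cancel₀ (stepVec_apply_ne_zero s) h1

lemma ext_of_ray {A : Finset (Site d)} {x : Site d} (s : Dir d)
    (h : ∀ k : ℕ, x + k • stepVec s ∉ A) : Ext A x :=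
  ⟨by simpa using h 0, infinite_conn_of_ray s fun k => h (k + 1)⟩

lemma add_nsmul_stepVec_same (x : Site d) (i : Fin d) (b : Bool) (k : ℕ) :
    (x + k • stepVec (i, b)) i = x i + if b then (k : ℤ) else -k := by
  cases b <;> simp [stepVec]

lemma add_nsmul_stepVec_ne (x : Site d) {i j : Fin d} (h : j ≠ i) (b : Bool) (k : ℕ) :
    (x + k • stepVec (i, b)) j = x j := by
  simp [stepVec, h]

lemma ext_erase_of_forall_le {A : Finset (Site d)} {x : Site d} (i : Fin d)
    (hxA : ∀ a ∈ A, x i ≤ a i) : Ext (A.erase x) x := by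
  refine infinite_conn_iff_ext_erase.1 (infinite_conn_of_ray (i, false) fun k hk => ?_)
  have := hxA _ hk
  rw [add_nsmul_stepVec_same] at this
  simp at this; omega

lemma exists_ext_erase [NeZero d] {A : Finset (Site d)} (hA : A.Nonempty) :
    ∃ x ∈ A, Ext (A.erase x) x := by
  obtain ⟨x, hx, hmin⟩ := A.exists_min_image (fun a => a 0) hA
  exact ⟨x, hx, ext_erase_of_forall_le 0 hmin⟩

/-! ### Positivity of the harmonic measure -/

lemma hitKer_pos_iff [NeZero d] {A : Finset (Site d)} {x y : Site d} :
    0 < hitKer A x y ↔ ∃ w, Conn A x w ∧ Adj w y := by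
  constructor
  · intro h
    obtain ⟨T, hT⟩ := lt_iSup_iff.1 h
    clear h
    induction T generalizing x with
    | zero => exact absurd hT (by simp [hitApprox])
    | succ T ih =>
      obtain ⟨s, hs⟩ := exists_step_of_avg_pos hT
      by_cases hy : x + stepVec s = y
      · exact ⟨x, Relation.ReflTransGen.refl, hy ▸ adj_add_stepVec x s⟩
      · rw [if_neg hy, zero_add] at hs
        split_ifs at hs with hA
        · exact absurd hs (lt_irrefl _)
        · obtain ⟨w, hw, hwy⟩ := ih hs
          exact ⟨w, Relation.ReflTransGen.head ⟨adj_add_stepVec x s, hA⟩ hw, hwy⟩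
  · rintro ⟨w, hw, hwy⟩
    induction hw using Relation.ReflTransGen.head_induction_on with
    | refl =>
      obtain ⟨s, rfl⟩ := adj_iff_exists_step.1 hwy
      rw [hitKer_eq_avg]
      refine avg_pos_of_step (s := s) ?_
      rw [if_pos rfl]
      exact lt_of_lt_of_le one_pos (self_le_add_right _ _)
    | head hab _ ih =>
      obtain ⟨s, rfl⟩ := adj_iff_exists_step.1 hab.1
      rw [hitKer_eq_avg]
      refine avg_pos_of_step (s := s) ?_
      rw [if_neg hab.2]
      exact lt_of_lt_of_le ih (self_le_add_left _ _)

lemma escape_pos_of_conn [NeZero d] {A : Finset (Site d)} {x y : Site d} (h : Conn A x y)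
    (hy : 0 < escape A y) : 0 < escape A x := by
  induction h using Relation.ReflTransGen.head_induction_on with
  | refl => exact hy
  | head hab _ ih =>
    obtain ⟨s, rfl⟩ := adj_iff_exists_step.1 hab.1
    rw [escape_eq_avg]
    exact avg_pos_of_step (s := s) (by rwa [if_neg hab.2])

/-- Far away, the expected number of visits to `A` is less than 1, so escape is possible from there;
an infinite set of reachable points contains such a far point. -/
lemma escape_pos_of_infinite [NeZero d] (hd : 5 ≤ d) {A : Finset (Site d)} {x : Site d}
    (h : {z | Conn A x z}.Infinite) : 0 < escape A x := by
  have ht : Tendsto (fun w => ∑ z ∈ A, visits w z) cofinite (𝓝 0) := by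
    simpa using tendsto_finsetSum A fun z _ => tendsto_visits_zero hd z
  obtain ⟨w, hw, hlt⟩ := (h.frequently_cofinite.and_eventually
    (ht.eventually (gt_mem_nhds one_pos))).exists
  refine escape_pos_of_conn hw ?_
  rw [escape_eq, tsub_pos_iff_lt]
  exact lt_of_le_of_lt (Finset.sum_le_sum fun z _ => hitKer_le_visits A w z) hlt

lemma tendsto_hitKer_ratio [NeZero d] (hd : 5 ≤ d) (A : Finset (Site d)) (y : Site d) :
    Tendsto (fun x => hitKer A x y / visits 0 x) cofinite (𝓝 (escape A y)) := by
  have hfin : ∀ z w : Site d, hitKer A z w ≠ ∞ := fun z w =>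
    ne_top_of_le_ne_top (visits_ne_top hd z w) (hitKer_le_visits A z w)
  have e : ∀ x, hitKer A x y / visits 0 x =
      visits y x / visits 0 x - ∑ z ∈ A, hitKer A y z * (visits z x / visits 0 x) := by
    intro x
    have hsum : ∑ z ∈ A, hitKer A y z * visits z x ≠ ∞ :=
      ENNReal.sum_ne_top.2 fun z _ => ENNReal.mul_ne_top (hfin _ _) (visits_ne_top hd _ _)
    have h1 : hitKer A x y = visits y x - ∑ z ∈ A, hitKer A y z * visits z x := by
      rw [hitKer_symm, visits_eq_first_visit A y x, ENNReal.add_sub_cancel_right hsum]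
    rw [h1, ENNReal.sub_div fun _ _ => (visits_pos 0 x).ne']
    simp only [div_eq_mul_inv, Finset.sum_mul, mul_assoc]
  simp only [e]
  rw [escape_eq]
  refine ENNReal.Tendsto.sub (tendsto_visits_ratio hd y) ?_ (Or.inl ENNReal.one_ne_top)
  refine tendsto_finsetSum A fun z _ => ?_
  simpa using ENNReal.Tendsto.const_mul (tendsto_visits_ratio hd z) (Or.inr (hfin y z))

instance infinite_site [NeZero d] : Infinite (Site d) := Pi.infinite_of_right

lemma sum_escape_pos [NeZero d] (hd : 5 ≤ d) {A : Finset (Site d)} (hA : A.Nonempty) :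
    ∑ z ∈ A, escape A z ≠ 0 := by
  obtain ⟨x, hx, hext⟩ := exists_ext_erase hA
  intro h
  have := (Finset.sum_eq_zero_iff.1 h) x hx
  exact (escape_pos_of_infinite hd (infinite_conn_iff_ext_erase.2 hext)).ne' this

/-- Numerator and denominator are both divided by `visits 0 x`. This convergence is what gives a
meaning to the `limUnder` in `harmonicMeasure`. -/
theorem tendsto_hitProb [NeZero d] (hd : 5 ≤ d) {A : Finset (Site d)} {y : Site d} (hy : y ∈ A) :
    Tendsto (fun x => hitProb A x y) cofinite (𝓝 (escape A y / ∑ z ∈ A, escape A z)) := by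
  have hle : ∀ z, escape A z ≠ ∞ := fun z => measure_ne_top _ _
  have := ENNReal.Tendsto.div (tendsto_hitKer_ratio hd A y)
    (Or.inr (sum_escape_pos hd ⟨y, hy⟩))
    (tendsto_finsetSum A fun z _ => tendsto_hitKer_ratio hd A z) (Or.inr (hle y))
  refine this.congr fun x => ?_
  rw [hitProb_eq_div hy]
  simp only [div_eq_mul_inv (hitKer _ _ _) (visits _ _), ← Finset.sum_mul]
  exact ENNReal.mul_div_mul_right _ _ (ENNReal.inv_ne_zero.2 (visits_ne_top hd _ _))
    (ENNReal.inv_ne_top.2 (visits_pos 0 x).ne')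

theorem harmonicMeasure_eq [NeZero d] (hd : 5 ≤ d) {A : Finset (Site d)} {y : Site d} (hy : y ∈ A) :
    harmonicMeasure A y = escape A y / ∑ z ∈ A, escape A z :=
  (tendsto_hitProb hd hy).limUnder_eq

lemma harmonicMeasure_eq_zero [NeZero d] {A : Finset (Site d)} {y : Site d} (hy : y ∉ A) :
    harmonicMeasure A y = 0 := by
  have : Tendsto (fun x => hitProb A x y) cofinite (𝓝 0) := by
    simp only [hitProb_eq_zero hy]
    exact tendsto_const_nhds
  exact this.limUnder_eq

theorem exposed_iff [NeZero d] (hd : 5 ≤ d) {A : Finset (Site d)} {y : Site d} :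
    Exposed A y ↔ y ∈ A ∧ Ext (A.erase y) y := by
  refine and_congr_right fun hy => ⟨fun h => ?_, fun h => ?_⟩
  · have ht := tendsto_hitProb hd hy
    rw [← harmonicMeasure_eq hd hy] at ht
    rw [← infinite_conn_iff_ext_erase]
    -- A positive limit makes the hitting kernel positive from almost every `x`; by symmetry the
    -- path can be read from `y` to `x`.
    have hev : ∀ᶠ x in cofinite, Conn A y x := by
      filter_upwards [ht.eventually (lt_mem_nhds h), A.finite_toSet.compl_mem_cofinite] with x hx hxA
      rw [hitProb_eq_div hy] at hx
      have hpos : 0 < hitKer A y x := by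
        rw [hitKer_symm]
        exact pos_iff_ne_zero.2 fun h0 => by simp [h0] at hx
      obtain ⟨w, hw, hwx⟩ := hitKer_pos_iff.1 hpos
      exact Relation.ReflTransGen.tail hw ⟨hwx, hxA⟩
    exact frequently_cofinite_iff_infinite.1 hev.frequently
  · rw [harmonicMeasure_eq hd hy]
    refine ENNReal.div_pos (escape_pos_of_infinite hd (infinite_conn_iff_ext_erase.2 h)).ne' ?_
    exact ENNReal.sum_ne_top.2 fun z _ => measure_ne_top _ _

/-! ### Positivity of the transition probabilities -/

lemma exists_walk_of_conn {A : Finset (Site d)} {x y z : Site d} (h : Conn A x y) (hz : Adj y z) :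
    ∃ (ω : ℕ → Dir d) (n : ℕ), (∀ k, 1 ≤ k → k ≤ n → walk x ω k ∉ A) ∧ walk x ω n = y ∧
      walk x ω (n + 1) = z := by
  induction h using Relation.ReflTransGen.head_induction_on with
  | refl =>
    obtain ⟨s, rfl⟩ := adj_iff_exists_step.1 hz
    exact ⟨fun _ => s, 0, fun k h1 h2 => by omega, walk_zero _ _, by rw [walk_succ, walk_zero]⟩
  | head hab _ ih =>
    obtain ⟨s, rfl⟩ := adj_iff_exists_step.1 hab.1
    obtain ⟨ω, n, h1, h2, h3⟩ := ih
    refine ⟨consSeq s ω, n + 1, fun k hk1 hk2 => ?_, by rwa [walk_consSeq_succ],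
      by rwa [walk_consSeq_succ]⟩
    obtain ⟨k, rfl⟩ : ∃ u, k = u + 1 := ⟨k - 1, by omega⟩
    rw [walk_consSeq_succ]
    rcases Nat.eq_zero_or_pos k with rfl | h0
    · rw [walk_zero]; exact hab.2
    · exact h1 k h0 (by omega)

lemma conn_walk {A : Finset (Site d)} {x : Site d} {ω : ℕ → Dir d} {n : ℕ}
    (h : ∀ k, 1 ≤ k → k ≤ n → walk x ω k ∉ A) : Conn A x (walk x ω n) := by
  induction n with
  | zero => rw [walk_zero]; exact Relation.ReflTransGen.refl
  | succ n ih =>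
    refine Relation.ReflTransGen.tail (ih fun k h1 h2 => h k h1 (by omega)) ⟨?_, h _ (by omega) le_rfl⟩
    rw [walk_succ]
    exact adj_add_stepVec _ _

lemma leaveProb_pos_iff [NeZero d] {A : Finset (Site d)} {x y : Site d} :
    0 < leaveProb A x y ↔ Conn A x y ∧ ∃ z ∈ A, Adj y z := by
  rw [leaveProb, cond_apply (measurableSet_hits A x)]
  constructor
  · intro h
    have hne : (hits A x ∩ {ω | walk x ω (tau A x ω - 1) = y}).Nonempty := by
      rw [Set.nonempty_iff_ne_empty]
      intro h0
      simp [h0] at h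
    obtain ⟨ω, hω, rfl⟩ := hne
    have ht := walk_tau_mem hω
    obtain ⟨n, hn⟩ : ∃ n, tau A x ω = n + 1 := ⟨tau A x ω - 1, by omega⟩
    rw [hn] at ht ⊢
    refine ⟨conn_walk fun k h1 h2 hA => ?_, _, ht.2, ?_⟩
    · exact Nat.notMem_of_lt_sInf (s := {t | 1 ≤ t ∧ walk x ω t ∈ A})
        (show k < tau A x ω by omega) ⟨h1, hA⟩
    · simp only [Nat.add_sub_cancel]
      rw [walk_succ]; exact adj_add_stepVec _ _
  · rintro ⟨hc, z, hz, hyz⟩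
    obtain ⟨ω, n, h1, h2, h3⟩ := exists_walk_of_conn hc hyz
    refine ENNReal.mul_pos (ENNReal.inv_ne_zero.2 (measure_ne_top _ _)) ?_
    -- The event contains the cylinder of all walks that begin with the given finite path.
    refine ((walkLaw_cylinder_pos ω (n + 1)).trans_le (measure_mono fun ω' hω' => ?_)).ne'
    have hw : ∀ k ≤ n + 1, walk x ω' k = walk x ω k := fun k hk =>
      walk_congr x fun j hj => hω' j (by omega)
    have hmem : n + 1 ∈ {t | 1 ≤ t ∧ walk x ω' t ∈ A} :=
      ⟨by omega, by rw [hw _ le_rfl, h3]; exact hz⟩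
    have htau : tau A x ω' = n + 1 := by
      refine le_antisymm (Nat.sInf_le hmem) (not_lt.1 fun hlt => ?_)
      have hm := Nat.sInf_mem (s := {t | 1 ≤ t ∧ walk x ω' t ∈ A}) ⟨_, hmem⟩
      have hlt' : sInf {t | 1 ≤ t ∧ walk x ω' t ∈ A} < n + 1 := hlt
      refine h1 _ hm.1 (by omega) ?_
      rw [← hw _ hlt'.le]
      exact hm.2
    refine ⟨⟨_, hmem⟩, ?_⟩
    rw [Set.mem_ofPred_eq, htau, Nat.add_sub_cancel, hw n (by omega), h2]

/-- HAT can make a transition from `U` to `W`: an exposed element `x` of `U` is transported to a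
point `y` adjacent to the rest, along a path which avoids the rest. -/
def Trans (U W : Finset (Site d)) : Prop :=
  ∃ x ∈ U, ∃ y, Ext (U.erase x) x ∧ Conn (U.erase x) x y ∧ (∃ z ∈ U.erase x, Adj y z) ∧
    W = insert y (U.erase x)

lemma actTransProb_pos_iff [NeZero d] (hd : 5 ≤ d) {U : Finset (Site d)} {x y : Site d} :
    0 < actTransProb U x y ↔ x ∈ U ∧ Ext (U.erase x) x ∧ Conn (U.erase x) x y ∧
      ∃ z ∈ U.erase x, Adj y z := by
  rw [actTransProb, ENNReal.mul_pos_iff, leaveProb_pos_iff, ← and_assoc (a := x ∈ U)]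
  refine and_congr_left fun _ => ?_
  rw [← exposed_iff hd, Exposed]
  by_cases hx : x ∈ U
  · simp [hx]
  · simp [hx, harmonicMeasure_eq_zero hx]

theorem transProb_pos_iff [NeZero d] (hd : 5 ≤ d) {U W : Finset (Site d)} :
    0 < transProb U W ↔ Trans U W := by
  rw [transProb, pos_iff_ne_zero, Ne, ENNReal.tsum_eq_zero, not_forall]
  simp only [ENNReal.tsum_eq_zero, not_forall]
  constructor
  · rintro ⟨x, y, h⟩
    rw [ite_eq_right_iff, Classical.not_imp] at h
    obtain ⟨hx, h1, h2, h3⟩ := (actTransProb_pos_iff hd).1 (pos_iff_ne_zero.2 h.2)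
    exact ⟨x, hx, y, h1, h2, h3, h.1.symm⟩
  · rintro ⟨x, hx, y, h1, h2, h3, rfl⟩
    exact ⟨x, y, by rw [if_pos rfl]; exact ((actTransProb_pos_iff hd).2 ⟨hx, h1, h2, h3⟩).ne'⟩

lemma mem_nonIso_iff [NeZero d] (hd : 5 ≤ d) {n : ℕ} {U : Finset (Site d)} :
    U ∈ NonIso d n ↔ U.card = n ∧ ∃ x ∈ U, Ext (U.erase x) x ∧ ∃ y ∈ U, Adj x y := by
  simp only [NonIso, Iso, Set.mem_ofPred_eq, exposed_iff hd]
  refine and_congr_right fun hc => ?_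
  simp only [hc, true_and, not_forall, not_not]
  constructor
  · rintro ⟨x, hx, y, hy, h⟩
    exact ⟨x, hx.1, hx.2, y, hy, h⟩
  · rintro ⟨x, hx1, hx2, y, hy, h⟩
    exact ⟨x, ⟨hx1, hx2⟩, y, hy, h⟩

/-- The transported element is itself the exposed element with a neighbor. -/
lemma Trans.mem_nonIso [NeZero d] (hd : 5 ≤ d) {U W : Finset (Site d)} (h : Trans U W) :
    W ∈ NonIso d U.card := by
  obtain ⟨x, hx, y, h1, h2, ⟨z, hz, hyz⟩, rfl⟩ := h
  have hy := h1.of_conn h2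
  rw [mem_nonIso_iff hd]
  refine ⟨?_, y, Finset.mem_insert_self _ _, by rwa [Finset.erase_insert hy.1], z,
    Finset.mem_insert_of_mem hz, hyz⟩
  rw [Finset.card_insert_of_notMem hy.1, Finset.card_erase_add_one hx]

/-! ### Reachability -/

lemma stepProb_pos_of_reflTransGen [NeZero d] (hd : 5 ≤ d) {U W : Finset (Site d)}
    (h : Relation.ReflTransGen Trans U W) : ∃ t, 0 < stepProb t U W := by
  induction h using Relation.ReflTransGen.head_induction_on with
  | refl => exact ⟨0, by simp [stepProb]⟩
  | @head a c hac _ ih =>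
    obtain ⟨t, ht⟩ := ih
    refine ⟨t + 1, ?_⟩
    rw [stepProb]
    refine lt_of_lt_of_le ?_ (ENNReal.le_tsum c)
    exact ENNReal.mul_pos ((transProb_pos_iff hd).2 hac).ne' ht.ne'

lemma reaches_of_transGen [NeZero d] (hd : 5 ≤ d) {U V W : Finset (Site d)}
    (h : Relation.TransGen Trans U W) (hVW : SameClass V W) : Reaches U V := by
  obtain ⟨U', hUU', hU'W⟩ := Relation.TransGen.head'_iff.1 h
  obtain ⟨t, ht⟩ := stepProb_pos_of_reflTransGen hd hU'W
  refine ⟨t + 1, by omega, ?_⟩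
  rw [classProb]
  refine lt_of_lt_of_le ?_ (ENNReal.le_tsum W)
  rw [if_pos hVW, stepProb]
  refine lt_of_lt_of_le ?_ (ENNReal.le_tsum U')
  exact ENNReal.mul_pos ((transProb_pos_iff hd).2 hUU').ne' ht.ne'

/-! ### Connectedness of the exterior -/

lemma update_eq_add_nsmul_stepVec (z : Site d) (j : Fin d) (c : ℤ) :
    Function.update z j c = z + (c - z j).natAbs • stepVec (j, decide (z j ≤ c)) := by
  ext i
  by_cases hi : i = j
  · subst hi
    rw [add_nsmul_stepVec_same, Function.update_self]
    rcases le_or_gt (z i) c with h | h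
    · simp only [h, decide_true, if_true]; omega
    · simp only [h.not_ge, decide_false, Bool.false_eq_true, if_false]; omega
  · rw [add_nsmul_stepVec_ne z hi, Function.update_of_ne hi]

lemma reflTransGen_of_hyperplane {P : Site d → Prop} {z z' : Site d} {i : Fin d}
    (h : ∀ w : Site d, w i = z i → P w) (hz : z' i = z i) :
    Relation.ReflTransGen (fun a b => Adj a b ∧ P b) z z' := by
  have key : ∀ s : Finset (Fin d),
      Relation.ReflTransGen (fun a b => Adj a b ∧ P b) z (s.piecewise z' z) := by
    intro s
    have hs : ∀ s : Finset (Fin d), s.piecewise z' z i = z i := fun s => by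
      by_cases his : i ∈ s <;> simp [his, hz]
    induction s using Finset.induction_on with
    | empty => rw [Finset.piecewise_empty]
    | insert j s _ ih =>
      by_cases hji : i = j
      · subst hji
        rwa [Finset.piecewise_insert, Function.update_eq_self_iff.2]
        rw [hs, hz]
      · rw [Finset.piecewise_insert, update_eq_add_nsmul_stepVec]
        refine ih.trans (reflTransGen_ray _ _ fun k _ => h _ ?_)
        rw [add_nsmul_stepVec_ne _ hji, hs]
  simpa using key Finset.univ

lemma conn_of_hyperplane {A : Finset (Site d)} {z z' : Site d} {i : Fin d}
    (h : ∀ a ∈ A, a i ≠ z i) (hz : z' i = z i) : Conn A z z' :=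
  reflTransGen_of_hyperplane (P := (· ∉ A)) (fun w hw hA => h w hA hw) hz

/-- An infinite component leaves the box that contains `A`. Outside the box, a point lies in a
coordinate hyperplane disjoint from `A`; two such hyperplanes with different normals meet, and two
parallel ones are joined through a third. -/
lemma Ext.conn (hd : 2 ≤ d) {A : Finset (Site d)} {x y : Site d} (hx : Ext A x) (hy : Ext A y) :
    Conn A x y := by
  obtain ⟨N, hN⟩ : ∃ N : ℤ, ∀ a ∈ A, ∀ i, |a i| ≤ N := by
    obtain ⟨M, hM⟩ := (A.image fun a => ∑ i, |a i|).exists_le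
    refine ⟨M, fun a ha i => le_trans ?_ (hM _ (Finset.mem_image_of_mem _ ha))⟩
    exact Finset.single_le_sum (f := fun i => |a i|) (fun _ _ => abs_nonneg _) (Finset.mem_univ i)
  have far : ∀ x, Ext A x → ∃ z, Conn A x z ∧ ∃ i, N < |z i| := by
    intro x hx
    by_contra! hc
    refine hx.2 ((Set.finite_Icc (fun _ : Fin d => -N) (fun _ => N)).subset fun z hz => ?_)
    exact ⟨fun i => (abs_le.1 (hc z hz i)).1, fun i => (abs_le.1 (hc z hz i)).2⟩
  have avoid : ∀ (z : Site d) i, N < |z i| → ∀ a ∈ A, a i ≠ z i := fun z i hi a ha h => by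
    have := hN a ha i
    rw [h] at this
    omega
  have outer_ne : ∀ (z z' : Site d) i j, i ≠ j → N < |z i| → N < |z' j| → Conn A z z' := by
    intro z z' i j hij hi hj
    refine (conn_of_hyperplane (z' := Function.update z j (z' j)) (avoid z i hi)
      (Function.update_of_ne hij _ _)).trans (conn_of_hyperplane (i := j) (avoid _ j ?_) ?_) <;> simp [hj]
  have outer : ∀ (z z' : Site d) i j, N < |z i| → N < |z' j| → Conn A z z' := by
    intro z z' i j hi hj
    by_cases hij : i = j
    · subst hij
      obtain ⟨k, hk⟩ : ∃ k : Fin d, k ≠ i := by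
        have : Nontrivial (Fin d) := Fin.nontrivial_iff_two_le.2 hd
        exact exists_ne i
      refine (conn_of_hyperplane (z' := Function.update z k (|N| + 1)) (avoid z i hi)
        (Function.update_of_ne hk.symm _ _)).trans (outer_ne _ z' k i hk ?_ hj)
      rw [Function.update_self, abs_of_nonneg (by positivity)]
      have := le_abs_self N
      omega
    · exact outer_ne z z' i j hij hi hj
  obtain ⟨z, hxz, i, hi⟩ := far x hx
  obtain ⟨z', hyz', j, hj⟩ := far y hy
  exact (hxz.trans (outer z z' i j hi hj)).trans (hyz'.symm hy.1)

/-- The two opposite rays from `x` in direction `j` stay in the hyperplane, and `p` can block only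
one of them. -/
lemma ext_of_hyperplane {A : Finset (Site d)} {x p : Site d} {i j : Fin d} (hij : i ≠ j)
    (hx : x ∉ A) (h : ∀ a ∈ A, a i = x i → a = p) : Ext A x := by
  by_contra hc
  have hray : ∀ b, ∃ k : ℕ, x + k • stepVec (j, b) ∈ A := fun b => by
    by_contra! hb
    exact hc (ext_of_ray (j, b) hb)
  obtain ⟨k, hk⟩ := hray true
  obtain ⟨l, hl⟩ := hray false
  have e : x + k • stepVec (j, true) = x + l • stepVec (j, false) := by
    rw [h _ hk (add_nsmul_stepVec_ne x hij _ _), h _ hl (add_nsmul_stepVec_ne x hij _ _)]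
  have e' := congrFun e j
  rw [add_nsmul_stepVec_same, add_nsmul_stepVec_same] at e'
  simp only [if_true, Bool.false_eq_true, if_false] at e'
  obtain rfl : k = 0 := by omega
  simp only [zero_nsmul, add_zero] at hk
  exact hx hk

/-! ### Reversible transitions -/

lemma Adj.ne {x y : Site d} (h : Adj x y) : x ≠ y := by
  rintro rfl
  simp [Adj] at h

/-- `y` is an exterior point of `A` which is adjacent to `A`. -/
def Attached (A : Finset (Site d)) (y : Site d) : Prop := Ext A y ∧ ∃ z ∈ A, Adj y z

lemma Attached.trans_insert (hd : 2 ≤ d) {A : Finset (Site d)} {y y' : Site d} (hy : Attached A y)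
    (hy' : Attached A y') : Trans (insert y A) (insert y' A) := by
  refine ⟨y, Finset.mem_insert_self _ _, y', ?_⟩
  rw [Finset.erase_insert hy.1.1]
  exact ⟨hy.1, hy.1.conn hd hy'.1, hy'.2, rfl⟩

lemma Attached.insert_mem_nonIso [NeZero d] (hd : 5 ≤ d) {A : Finset (Site d)} {y : Site d}
    (hy : Attached A y) : insert y A ∈ NonIso d (A.card + 1) := by
  have := (hy.trans_insert (by omega) hy).mem_nonIso hd
  rwa [Finset.card_insert_of_notMem hy.1.1] at this

lemma exists_eq_insert_of_mem_nonIso [NeZero d] (hd : 5 ≤ d) {n : ℕ} {U : Finset (Site d)}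
    (hU : U ∈ NonIso d n) : ∃ A y, Attached A y ∧ U = insert y A ∧ A.card + 1 = n := by
  obtain ⟨hc, x, hx, hext, y, hy, hxy⟩ := (mem_nonIso_iff hd).1 hU
  refine ⟨U.erase x, x, ⟨hext, y, Finset.mem_erase.2 ⟨hxy.ne.symm, hy⟩, hxy⟩, ?_, ?_⟩
  · rw [Finset.insert_erase hx]
  · rw [Finset.card_erase_add_one hx, hc]

/-- An element `x` of `A` can be moved to a neighboring point `x'`, in such a way that each of the
two points is in the exterior when the other one is occupied. -/
def Slide (A A' : Finset (Site d)) : Prop :=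
  ∃ B x x', Adj x x' ∧ A = insert x B ∧ A' = insert x' B ∧ Ext A x' ∧ Ext A' x

lemma Slide.symm {A A' : Finset (Site d)} (h : Slide A A') : Slide A' A := by
  obtain ⟨B, x, x', h1, h2, h3, h4, h5⟩ := h
  exact ⟨B, x', x, adj_comm.1 h1, h3, h2, h5, h4⟩

lemma reflTransGen_slide_symm {A A' : Finset (Site d)} (h : Relation.ReflTransGen Slide A A') :
    Relation.ReflTransGen Slide A' A := by
  induction h with
  | refl => exact Relation.ReflTransGen.refl
  | tail _ hbc ih => exact Relation.ReflTransGen.head hbc.symm ih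

/-- To slide `x` to `x'`, the free element is sent to `x'`, next to `x`. The roles are then
exchanged: the element at `x'` counts as the slid one, and the one at `x` becomes free and goes to
`y'`. -/
lemma reflTransGen_trans_of_slide (hd : 2 ≤ d) {A A' : Finset (Site d)}
    (h : Relation.ReflTransGen Slide A A') {y y' : Site d} (hy : Attached A y)
    (hy' : Attached A' y') : Relation.ReflTransGen Trans (insert y A) (insert y' A') := by
  induction h generalizing y' with
  | refl => exact Relation.ReflTransGen.single (hy.trans_insert hd hy')
  | tail _ hbc ih =>
    obtain ⟨B, x, x', hadj, rfl, rfl, h1, h2⟩ := hbc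
    have a1 : Attached (insert x B) x' := ⟨h1, x, Finset.mem_insert_self _ _, adj_comm.1 hadj⟩
    have a2 : Attached (insert x' B) x := ⟨h2, x', Finset.mem_insert_self _ _, hadj⟩
    have := ih a1
    rw [Finset.insert_comm] at this
    exact this.tail (a2.trans_insert hd hy')

/-! ### Sliding every configuration to a segment -/

/-- At each step, the hyperplane through either of the two sites contains no element of `C`, hence
at most the moving element, and `ext_of_hyperplane` applies. -/
lemma reflTransGen_slide_of_free {i j : Fin d} (hij : i ≠ j) {C : Finset (Site d)} {x y : Site d}
    (hx : ∀ c ∈ C, c i ≠ x i)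
    (h : Relation.ReflTransGen (fun a b => Adj a b ∧ ∀ c ∈ C, c i ≠ b i) x y) :
    Relation.ReflTransGen Slide (insert x C) (insert y C) := by
  have hext : ∀ a b : Site d, Adj a b → (∀ c ∈ C, c i ≠ b i) → Ext (insert a C) b := by
    intro a b hab hb
    refine ext_of_hyperplane (p := a) hij ?_ fun c hc hci => ?_
    · rw [Finset.mem_insert, not_or]
      exact ⟨hab.ne.symm, fun hC => hb b hC rfl⟩
    · rcases Finset.mem_insert.1 hc with rfl | hc
      · rfl
      · exact absurd hci (hb c hc)
  induction h using Relation.ReflTransGen.head_induction_on with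
  | refl => exact Relation.ReflTransGen.refl
  | @head a b hab _ ih =>
    refine Relation.ReflTransGen.head ⟨C, a, b, hab.1, rfl, rfl, hext a b hab.1 hab.2,
      hext b a (adj_comm.1 hab.1) hx⟩ (ih hab.2)

/-- The segment of the points `(p + j, 0, …, 0)`, `1 ≤ j ≤ m`. -/
def seg [NeZero d] (p : ℤ) (m : ℕ) : Finset (Site d) :=
  (Finset.Icc 1 m).image fun j : ℕ => Pi.single 0 (p + j)

lemma seg_succ [NeZero d] (p : ℤ) (m : ℕ) :
    (seg p (m + 1) : Finset (Site d)) = insert (Pi.single 0 (p + m + 1)) (seg p m) := by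
  rw [seg, ← Finset.insert_Icc_right_eq_Icc_add_one (by omega), Finset.image_insert]
  simp [seg, add_assoc]

lemma seg_add_two [NeZero d] (p : ℤ) (m : ℕ) : (seg p (m + 2) : Finset (Site d)) =
    insert (Pi.single 0 (p + m + 2)) (seg p (m + 1)) := by
  rw [seg_succ, show p + ((m + 1 : ℕ) : ℤ) + 1 = p + m + 2 by push_cast; ring]

lemma le_of_mem_seg [NeZero d] {p : ℤ} {m : ℕ} {x : Site d} (hx : x ∈ seg p m) : x 0 ≤ p + m := by
  obtain ⟨j, hj, rfl⟩ := Finset.mem_image.1 hx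
  have := (Finset.mem_Icc.1 hj).2
  simp only [Pi.single_eq_same]; omega

lemma card_seg [NeZero d] (p : ℤ) (m : ℕ) : (seg p m : Finset (Site d)).card = m := by
  rw [seg, Finset.card_image_of_injective, Nat.card_Icc, Nat.add_sub_cancel]
  intro a b h
  have := congrFun h 0
  simp only [Pi.single_eq_same] at this
  omega

lemma fin_zero_ne_one [NeZero d] (hd : 2 ≤ d) : (0 : Fin d) ≠ ⟨1, hd⟩ := by
  simp [Fin.ext_iff]

lemma attached_seg [NeZero d] (hd : 2 ≤ d) (p : ℤ) (m : ℕ) :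
    Attached (seg p (m + 1) : Finset (Site d)) (Pi.single 0 (p + m + 2)) := by
  have hlt : ∀ a ∈ (seg p (m + 1) : Finset (Site d)),
      a 0 < (Pi.single 0 (p + m + 2) : Site d) 0 := fun a ha => by
    have := le_of_mem_seg ha
    simp only [Pi.single_eq_same]; push_cast at this; omega
  refine ⟨ext_of_hyperplane (p := 0) (fin_zero_ne_one hd) (fun h => (hlt _ h).ne rfl)
    fun a ha h => absurd h (hlt a ha).ne, Pi.single 0 (p + m + 1), ?_, ?_⟩
  · rw [seg_succ]; exact Finset.mem_insert_self _ _
  · rw [adj_comm, adj_iff_exists_step]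
    refine ⟨(0, true), ?_⟩
    rw [stepVec, ← Pi.single_add]
    simp [add_assoc]

/-- The target lies in an empty hyperplane. The vacated site `a` is exterior by the ray along which
coordinate 1 decreases, since `a` has the least coordinate 1 in its layer. -/
lemma slide_lexMin [NeZero d] (hd : 2 ≤ d) {C : Finset (Site d)} {a : Site d} (haC : a ∉ C)
    (h : ∀ c ∈ C, c 0 < a 0 - 1 ∨ a 0 < c 0 ∨ (c 0 = a 0 ∧ a ⟨1, hd⟩ ≤ c ⟨1, hd⟩)) :
    Slide (insert a C) (insert (a + stepVec (0, false)) C) := by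
  have h01 := fin_zero_ne_one hd
  have h0 : (a + stepVec (0, false) : Site d) 0 = a 0 - 1 := by simp [stepVec, sub_eq_add_neg]
  refine ⟨C, a, _, adj_add_stepVec a (0, false), rfl, rfl, ?_, ?_⟩
  · have hne : ∀ c ∈ insert a C, c 0 ≠ a 0 - 1 := by
      intro c hc
      rcases Finset.mem_insert.1 hc with rfl | hc
      · omega
      · have := h c hc; omega
    exact ext_of_hyperplane (p := 0) h01 (fun hmem => hne _ hmem h0)
      fun c hc hc0 => absurd (hc0.trans h0) (hne c hc)
  · refine ext_of_ray (⟨1, hd⟩, false) fun k hk => ?_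
    have e0 : (a + k • stepVec (⟨1, hd⟩, false) : Site d) 0 = a 0 := add_nsmul_stepVec_ne a h01 _ _
    have e1 := add_nsmul_stepVec_same a ⟨1, hd⟩ false k
    simp only [Bool.false_eq_true, if_false] at e1
    rcases Finset.mem_insert.1 hk with hk | hk
    · rw [hk] at e0; omega
    · have := h _ hk
      obtain rfl : k = 0 := by omega
      simp only [zero_nsmul, add_zero] at hk
      exact haC hk

/-- Here `B` is what remains to be appended to the segment. The lower bound on `B` depends only on
`k + m`, so it survives the induction; as long as `B` is nonempty it keeps the layer `p + k + 1`
empty. -/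
lemma reflTransGen_slide_union_seg [NeZero d] (hd : 2 ≤ d) (p : ℤ) (m : ℕ) :
    ∀ (B : Finset (Site d)) (k : ℕ), B.card = m → (∀ b ∈ B, p + k + 1 + m ≤ b 0) →
      Relation.ReflTransGen Slide (B ∪ seg p k) (seg p (k + m)) := by
  induction m with
  | zero =>
    intro B k hB _
    rw [Finset.card_eq_zero.1 hB, Finset.empty_union]
    exact Relation.ReflTransGen.refl
  | succ m ih =>
    intro B k hB hp
    obtain ⟨a, ha, hmin⟩ := B.exists_min_image (fun b => toLex (b 0, b ⟨1, hd⟩))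
      (Finset.card_pos.1 (by omega))
    have hlex : ∀ b ∈ B, a 0 < b 0 ∨ (b 0 = a 0 ∧ a ⟨1, hd⟩ ≤ b ⟨1, hd⟩) := fun b hb => by
      have := hmin b hb
      rw [Prod.Lex.toLex_le_toLex] at this
      rcases this with h | ⟨h, h'⟩
      · exact Or.inl h
      · exact Or.inr ⟨h.symm, h'⟩
    set B' := B.erase a with hB'
    set C := B' ∪ seg p k with hC
    have hap := hp a ha
    push_cast at hap
    have hCmem : ∀ c ∈ C, c 0 ≤ p + k ∨ c ∈ B' := fun c hc => by
      rcases Finset.mem_union.1 hc with h | h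
      · exact Or.inr h
      · exact Or.inl (le_of_mem_seg h)
    have haC : a ∉ C := fun h => by
      rcases hCmem a h with h | h
      · omega
      · exact Finset.notMem_erase a B h
    have e1 : B ∪ seg p k = insert a C := by
      rw [hC, ← Finset.insert_union, Finset.insert_erase ha]
    have e2 : insert (Pi.single 0 (p + k + 1)) C = B' ∪ seg p (k + 1) := by
      rw [seg_succ, Finset.union_insert]
    have hfree : ∀ x : Site d, p + k < x 0 → x 0 < a 0 → ∀ c ∈ C, c 0 ≠ x 0 := fun x h1 h2 c hc => by
      rcases hCmem c hc with h | h
      · omega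
      · have := hlex c (Finset.mem_of_mem_erase h); omega
    set x := a + stepVec (0, false) with hx
    have hx0 : x 0 = a 0 - 1 := by simp [hx, stepVec, sub_eq_add_neg]
    obtain ⟨l, hl⟩ : ∃ l : ℕ, x 0 = p + k + 1 + l := ⟨(x 0 - (p + k + 1)).toNat, by omega⟩
    -- The element goes straight left to the layer `p + k + 1`, then inside this empty layer to the
    -- axis.
    have hpath : Relation.ReflTransGen (fun a b => Adj a b ∧ ∀ c ∈ C, c 0 ≠ b 0) x
        (Pi.single 0 (p + k + 1)) := by
      have hcoord : ∀ r : ℕ, (x + r • stepVec (0, false) : Site d) 0 = x 0 - r := fun r => by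
        rw [add_nsmul_stepVec_same]; simp [sub_eq_add_neg]
      refine (reflTransGen_ray (P := fun b => ∀ c ∈ C, c 0 ≠ b 0) (0, false) l fun r hr => ?_).trans
        (reflTransGen_of_hyperplane (P := fun b => ∀ c ∈ C, c 0 ≠ b 0) (i := 0)
          (fun w hw => hfree w ?_ ?_) ?_)
      · have := hcoord (r + 1)
        push_cast at this
        exact hfree _ (by omega) (by omega)
      · have := hcoord l; omega
      · have := hcoord l; omega
      · have := hcoord l
        simp only [Pi.single_eq_same]; omega
    rw [e1]
    refine Relation.ReflTransGen.head (slide_lexMin hd haC fun c hc => ?_) ?_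
    · rcases hCmem c hc with h | h
      · exact Or.inl (by omega)
      · exact Or.inr (hlex c (Finset.mem_of_mem_erase h))
    refine (reflTransGen_slide_of_free (fin_zero_ne_one hd) (hfree x (by omega) (by omega))
      hpath).trans ?_
    rw [e2, show k + (m + 1) = k + 1 + m by ring]
    refine ih B' (k + 1) ?_ fun b hb => ?_
    · rw [hB', Finset.card_erase_of_mem ha, hB, Nat.add_sub_cancel]
    · have := hp b (Finset.mem_of_mem_erase hb)
      push_cast at this ⊢
      omega

lemma exists_slide_seg [NeZero d] (hd : 2 ≤ d) (A : Finset (Site d)) :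
    ∃ p, Relation.ReflTransGen Slide A (seg p A.card) := by
  obtain ⟨M, hM⟩ := (A.image fun a => -a 0).exists_le
  -- This solves `p + 0 + 1 + A.card = -M`, where `-M` is a lower bound for coordinate 0 on `A`.
  refine ⟨-M - 1 - A.card, ?_⟩
  have := reflTransGen_slide_union_seg hd (-M - 1 - A.card) A.card A 0 rfl fun b hb => ?_
  · simpa [seg] using this
  · have := hM _ (Finset.mem_image_of_mem _ hb)
    push_cast; omega

/-- All elements but the free one slide to a segment of length `n - 1`, and the free one ends as its
right end. Reversing the slides gives the way back. -/
lemma exists_reflTransGen_seg [NeZero d] (hd : 5 ≤ d) {n : ℕ} (hn : 2 ≤ n) {U : Finset (Site d)}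
    (hU : U ∈ NonIso d n) : ∃ p, Relation.ReflTransGen Trans U (seg p n) ∧
      Relation.ReflTransGen Trans (seg p n) U := by
  obtain ⟨A, y, hy, rfl, hc⟩ := exists_eq_insert_of_mem_nonIso hd hU
  obtain ⟨p, hp⟩ := exists_slide_seg (by omega) A
  obtain ⟨m, rfl⟩ : ∃ m, n = m + 2 := ⟨n - 2, by omega⟩
  obtain hc : A.card = m + 1 := by omega
  rw [hc] at hp
  have hs := attached_seg (d := d) (by omega) p m
  refine ⟨p, ?_, ?_⟩ <;> rw [seg_add_two]
  · exact reflTransGen_trans_of_slide (by omega) hp hy hs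
  · exact reflTransGen_trans_of_slide (by omega) (reflTransGen_slide_symm hp) hs hy

lemma seg_mem_nonIso [NeZero d] (hd : 5 ≤ d) {n : ℕ} (hn : 2 ≤ n) (p : ℤ) :
    (seg p n : Finset (Site d)) ∈ NonIso d n := by
  obtain ⟨m, rfl⟩ : ∃ m, n = m + 2 := ⟨n - 2, by omega⟩
  have h := (attached_seg (d := d) (by omega) p m).insert_mem_nonIso hd
  rw [card_seg] at h
  rwa [seg_add_two]

lemma trans_self_of_mem_nonIso [NeZero d] (hd : 5 ≤ d) {n : ℕ} {U : Finset (Site d)}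
    (hU : U ∈ NonIso d n) : Trans U U := by
  obtain ⟨A, y, hy, rfl, -⟩ := exists_eq_insert_of_mem_nonIso hd hU
  exact hy.trans_insert (by omega) hy

/-- A leftmost element is exposed; it can be carried to the right side of a rightmost element among
the others. -/
lemma exists_trans [NeZero d] (hd : 2 ≤ d) {U : Finset (Site d)} (hU : 2 ≤ U.card) :
    ∃ W, Trans U W := by
  obtain ⟨x, hx, hmin⟩ := U.exists_min_image (fun a => a 0) (Finset.card_pos.1 (by omega))
  have hne : (U.erase x).Nonempty := by
    rw [← Finset.card_pos, Finset.card_erase_of_mem hx]; omega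
  obtain ⟨m, hm, hmax⟩ := (U.erase x).exists_max_image (fun a => a 0) hne
  have hlt : ∀ a ∈ U.erase x, a 0 < (m + stepVec (0, true) : Site d) 0 := fun a ha => by
    have := hmax a ha
    simp only [Pi.add_apply, stepVec, if_true, Pi.single_eq_same]; omega
  have hext := ext_erase_of_forall_le 0 hmin
  have hy : Ext (U.erase x) (m + stepVec (0, true)) :=
    ext_of_hyperplane (p := 0) (fin_zero_ne_one hd) (fun h => (hlt _ h).ne rfl)
      fun a ha h => absurd h (hlt a ha).ne
  exact ⟨_, x, hx, _, hext, hext.conn hd hy, ⟨m, hm, adj_comm.1 (adj_add_stepVec _ _)⟩, rfl⟩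

/-! ### Translations -/

/-- The translate of `A` by `v`. -/
def translate (v : Site d) (A : Finset (Site d)) : Finset (Site d) :=
  A.map (Equiv.addRight v).toEmbedding

lemma add_mem_translate {v x : Site d} {A : Finset (Site d)} : x + v ∈ translate v A ↔ x ∈ A := by
  simp [translate]

lemma Conn.translate {A : Finset (Site d)} {x y : Site d} (h : Conn A x y) (v : Site d) :
    Conn (translate v A) (x + v) (y + v) := by
  induction h with
  | refl => exact Relation.ReflTransGen.refl
  | tail _ hbc ih =>
    refine Relation.ReflTransGen.tail ih ⟨?_, fun h => hbc.2 (add_mem_translate.1 h)⟩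
    simpa [Adj] using hbc.1

lemma Ext.translate {A : Finset (Site d)} {x : Site d} (h : Ext A x) (v : Site d) :
    Ext (translate v A) (x + v) :=
  ⟨fun h' => h.1 (add_mem_translate.1 h'),
    (h.2.image (add_left_injective v).injOn).mono <| by
      rintro _ ⟨z, hz, rfl⟩
      exact Conn.translate hz v⟩

lemma translate_erase (v x : Site d) (A : Finset (Site d)) :
    translate v (A.erase x) = (translate v A).erase (x + v) := by
  rw [translate, Finset.map_erase]; rfl

lemma Trans.translate {U W : Finset (Site d)} (h : Trans U W) (v : Site d) :
    Trans (translate v U) (translate v W) := by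
  obtain ⟨x, hx, y, h1, h2, ⟨z, hz, hyz⟩, rfl⟩ := h
  refine ⟨x + v, add_mem_translate.2 hx, y + v, ?_⟩
  rw [← translate_erase]
  refine ⟨h1.translate v, h2.translate v, ⟨z + v, add_mem_translate.2 hz, ?_⟩, ?_⟩
  · simpa [Adj] using hyz
  · rw [HAT.translate, Finset.map_insert]; rfl

lemma sameClass_translate (v : Site d) (A : Finset (Site d)) : SameClass A (translate v A) :=
  ⟨Equiv.addRight v, fun x y => by simp, rfl⟩

lemma translate_seg [NeZero d] (p q : ℤ) (m : ℕ) :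
    translate (Pi.single 0 q) (seg p m : Finset (Site d)) = seg (p + q) m := by
  rw [translate, seg, Finset.map_eq_image, Finset.image_image, seg]
  refine congrArg (fun f => Finset.image f _) (funext fun j => ?_)
  simp only [Function.comp_apply, Equiv.coe_toEmbedding, Equiv.coe_addRight]
  rw [← Pi.single_add]
  congr 1; ring

lemma line_eq_seg [NeZero d] (m : ℕ) : line d m = seg 0 m := by
  rw [line, seg]
  refine congrArg (fun f => Finset.image f _) (funext fun j => funext fun i => ?_)
  by_cases hi : i = 0
  · subst hi; simp
  · have : (i : ℕ) ≠ 0 := fun h => hi (Fin.ext (by simpa using h))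
    simp [hi, this]

lemma reaches_of_mem_nonIso [NeZero d] (hd : 5 ≤ d) {n : ℕ} (hn : 2 ≤ n) {U V : Finset (Site d)}
    (hU : U ∈ NonIso d n) (hV : V ∈ NonIso d n) : Reaches U V := by
  obtain ⟨p, hUp, -⟩ := exists_reflTransGen_seg hd hn hU
  obtain ⟨q, -, hqV⟩ := exists_reflTransGen_seg hd hn hV
  -- The two segments may differ in position; the path from the second one to `V` is shifted so that
  -- it starts at the first one.
  have h := Relation.ReflTransGen.lift (p := Trans) (translate (Pi.single 0 (p - q)))
    (fun _ _ h => Trans.translate h _) _ _ hqV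
  change Relation.ReflTransGen _ _ _ at h
  rw [translate_seg, add_sub_cancel] at h
  -- The initial transition from `U` to itself guarantees `t ≥ 1`, even if the rest of the path is
  -- trivial.
  exact reaches_of_transGen hd (Relation.TransGen.head' (trans_self_of_mem_nonIso hd hU)
    (hUp.trans h)) (sameClass_translate _ V)

end HAT

end

theorem theorem1p4 (d n : ℕ) (hd : 5 ≤ d) (hn : 4 ≤ n) :
    HAT.IrreducibleOn (HAT.NonIso d n) ∧
      (∀ U : Finset (HAT.Site d), U.card = n → HAT.Reaches U (HAT.line d n)) ∧
      (∀ U ∈ HAT.NonIso d n, HAT.Reaches (HAT.line d n) U) := by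
  have : NeZero d := ⟨by omega⟩
  have hline : HAT.line d n ∈ HAT.NonIso d n := by
    rw [HAT.line_eq_seg]; exact HAT.seg_mem_nonIso hd (by omega) 0
  refine ⟨⟨fun U hU W hW => ?_, fun U hU V hV => HAT.reaches_of_mem_nonIso hd (by omega) hU hV⟩,
    fun U hU => ?_, fun U hU => HAT.reaches_of_mem_nonIso hd (by omega) hline hU⟩
  · have := ((HAT.transProb_pos_iff hd).1 hW).mem_nonIso hd
    rwa [hU.1] at this
  · obtain ⟨W, hW⟩ := HAT.exists_trans (by omega) (U := U) (by omega)
    have hWn := hW.mem_nonIso hd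
    rw [hU] at hWn
    obtain ⟨p, hp, -⟩ := HAT.exists_reflTransGen_seg hd (by omega) hWn
    refine HAT.reaches_of_transGen hd (Relation.TransGen.head' hW hp) ?_
    have := HAT.translate_seg (d := d) 0 p n
    rw [zero_add] at this
    rw [HAT.line_eq_seg, ← this]
    exact HAT.sameClass_translate _ _
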